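/- **Definitions.** An oriented graph is a directed graph without loops in which any two vertices are joined by at most one edge; $\|H\|$ denotes the number of edges of $H$. The density $t(H,G)$ of an oriented graph $H$ in a finite oriented graph $G$ is the probability that a uniformly random mapping $V(H)\to V(G)$ is a homomorphism. A sequence $(T_i)$ of tournaments is *quasirandom* if $t(H,T_i)\to 2^{-\|H\|}$ for every oriented graph $H$. A *tournamenton* is a non-negative measurable function $W:[0,1]^2\to\mathbb R$ with $W(x,y)+W(y,x)=1$ for all $x,y$, and $t(H,W)=\int_{[0,1]^{V(H)}}\prod_{vw\in E(H)}W(x_v,x_w)\,dx$. An oriented graph $H$ is *quasirandom-forcing* if for every sequence $(T_i)$ of tournaments with $|T_i|\to\infty$, the sequence is quasirandom if and only if $t(H,T_i)\to 2^{-\|H\|}$. In the language of limits, $H$ is *quasirandom-forcing* if every tournamenton $W$ with $t(H,W)=2^{-\|H\|}$ equals $1/2$ almost everywhere. For $n\ge 1$, let $Q_{2n}$ be the path with $2n$ edges, all oriented from its central vertex towards its two end vertices. For $k\ge 2$, let $D_{2k}$ be the cycle of length $2k$ with all edges oriented in the direction from one of two opposite vertices to the other. For an orientation $C$ of a cycle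 and positive integers $n_1,\dots,n_m$ with $m\ge 1$, let $\alpha_C(2n_1,\dots,2n_m)$ be the number of sets $F\subseteq E(C)$ such that the spanning subgraph of $C$ with edge set $F$ can be obtained, up to isomorphism, from the disjoint union $Q_{2n_1}\cup\dots\cup Q_{2n_m}$ by reversing an even number of edges and possibly adding isolated vertices, minus the number of sets $F\subseteq E(C)$ for which it can be obtained in this way by reversing an odd number of edges. If $C$ has even length $2k$, let $\gamma_C=1$ if $C$ can be obtained, up to isomorphism, from $D_{2k}$ by reversing an even number of edges, and $\gamma_C=-1$ otherwise. **Theorem.** Let $C$ be an orientation of a cycle of even length $2k\ge 4$. If $\gamma_C=1$ and $\alpha_C(2n_1,\dots,2n_m)\ge 0$ for all $m\ge1$ and all positive integers $n_1,\dots,n_m$, then $C$ is quasirandom-forcing, in both senses above. Similarly, if $\gamma_C=-1$ and $\alpha_C(2n_1,\dots,2n_m)\le 0$ for all $m\ge1$ and all positive integers $n_1,\dots,n_m$, then $C$ is quasirandom-forcing, in both senses above. -/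

import Mathlib

open MeasureTheory Filter
open scoped Topology unitInterval

/-- An oriented graph: a directed graph such that no two vertices are joined in both directions
(in particular, there are no loops). -/
structure OrientedGraph (V : Type*) extends Digraph V where
  asymm : ∀ u v, Adj u v → ¬ Adj v u

namespace OrientedGraph

variable {V W : Type*}

/-- An oriented graph is a tournament if any two distinct vertices are joined by an edge. -/
def IsTournament (G : OrientedGraph V) : Prop :=
  ∀ u v, u ≠ v → G.Adj u v ∨ G.Adj v u

/-- `C` is an orientation of a cycle of length `ℓ` (to be used with `3 ≤ ℓ`). -/
def IsCycleOrientation (C : OrientedGraph V) (ℓ : ℕ) : Prop :=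
  Nonempty (C.toDigraph.toSimpleGraphInclusive ≃g SimpleGraph.cycleGraph ℓ)

open Classical in
/-- The edge set `E(H)`; the edge from `u` to `v` is the ordered pair `(u, v)`. -/
noncomputable def edges [Fintype V] (H : OrientedGraph V) : Finset (V × V) :=
  Finset.univ.filter fun e => H.Adj e.1 e.2

/-- The spanning subgraph of `H` formed by the edges of `H` that belong to `F`. -/
def spanning (H : OrientedGraph V) (F : Finset (V × V)) : OrientedGraph V where
  Adj u v := H.Adj u v ∧ (u, v) ∈ F
  asymm u v h h' := H.asymm u v h.1 h'.1

/-- The oriented graph obtained from `H` by reversing the edges of `H` that belong to `R`. -/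
def reverse (H : OrientedGraph V) (R : Finset (V × V)) : OrientedGraph V where
  Adj u v := (H.Adj u v ∧ (u, v) ∉ R) ∨ (H.Adj v u ∧ (v, u) ∈ R)
  asymm u v h h' := by
    have := H.asymm u v
    tauto

/-- The image of `H` under an injection `f`; up to isomorphism, it is obtained from `H` by adding
isolated vertices, one for each vertex outside the range of `f`. -/
def map (H : OrientedGraph V) (f : V ↪ W) : OrientedGraph W where
  Adj x y := ∃ u v, H.Adj u v ∧ f u = x ∧ f v = y
  asymm := by
    rintro x y ⟨u, v, h, rfl, rfl⟩ ⟨u', v', h', hu, hv⟩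
    rw [f.injective hu, f.injective hv] at h'
    exact H.asymm u v h h'

/-- The disjoint union of a family of oriented graphs. -/
def disjointUnion {ι : Type*} {X : ι → Type*} (H : ∀ i, OrientedGraph (X i)) :
    OrientedGraph (Σ i, X i) where
  Adj p q := ∃ i a b, (H i).Adj a b ∧ p = ⟨i, a⟩ ∧ q = ⟨i, b⟩
  asymm := by
    rintro p q ⟨i, a, b, h, rfl, rfl⟩ ⟨j, c, d, h', h1, h2⟩
    obtain ⟨rfl, h1⟩ := Sigma.mk.inj_iff.1 h1
    obtain ⟨-, h2⟩ := Sigma.mk.inj_iff.1 h2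
    cases h1
    cases h2
    exact (H i).asymm _ _ h h'

/-- The path `Q_{2n}` with vertices `0, 1, …, 2n` and all `2n` edges oriented from the central
vertex `n` towards the two end vertices `0` and `2n`. -/
def Q (n : ℕ) : OrientedGraph (Fin (2 * n + 1)) where
  Adj i j := (n ≤ i.val ∧ j.val = i.val + 1) ∨ (i.val ≤ n ∧ i.val = j.val + 1)
  asymm i j h h' := by omega

/-- The cycle `D_{2k}` with vertices `0, 1, …, 2k - 1` in this cyclic order and all edges oriented
in the direction from the vertex `0` to the opposite vertex `k`. -/
def D (k : ℕ) : OrientedGraph (Fin (2 * k)) where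
  Adj i j := (i.val < k ∧ j.val = i.val + 1) ∨ (k ≤ j.val ∧ i.val = (j.val + 1) % (2 * k))
  asymm i j h h' := by
    have hi := i.isLt
    have hj := j.isLt
    rcases Nat.lt_or_ge (i.val + 1) (2 * k) with h1 | h1 <;>
      rcases Nat.lt_or_ge (j.val + 1) (2 * k) with h2 | h2
    · rw [Nat.mod_eq_of_lt h2] at h
      rw [Nat.mod_eq_of_lt h1] at h'
      omega
    · have h3 : j.val + 1 = 2 * k := by omega
      rw [h3, Nat.mod_self] at h
      rw [Nat.mod_eq_of_lt h1] at h'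
      omega
    · have h3 : i.val + 1 = 2 * k := by omega
      rw [h3, Nat.mod_self] at h'
      rw [Nat.mod_eq_of_lt h2] at h
      omega
    · have h3 : i.val + 1 = 2 * k := by omega
      have h4 : j.val + 1 = 2 * k := by omega
      rw [h4, Nat.mod_self] at h
      omega

/-- The number of sets `F ⊆ E(C)` such that the spanning subgraph of `C` with edge set `F` can be
obtained from `Q_{2n_1} ∪ ⋯ ∪ Q_{2n_m}` by reversing a set of edges whose size satisfies `parity`
and possibly adding some isolated vertices. -/
noncomputable def pathCount [Fintype V] (C : OrientedGraph V) (parity : ℕ → Prop)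
    {m : ℕ} (n : Fin m → ℕ) : ℕ :=
  Set.ncard {F : Finset (V × V) | F ⊆ C.edges ∧
    ∃ R ⊆ (disjointUnion fun i => Q (n i)).edges, parity R.card ∧
      ∃ f : (Σ i, Fin (2 * n i + 1)) ↪ V,
        C.spanning F = ((disjointUnion fun i => Q (n i)).reverse R).map f}

/-- The coefficient `α_C(2n_1, …, 2n_m)`. -/
noncomputable def alpha [Fintype V] (C : OrientedGraph V) {m : ℕ} (n : Fin m → ℕ) : ℤ :=
  (C.pathCount Even n : ℤ) - (C.pathCount Odd n : ℤ)

open Classical in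
/-- The sign `γ_C` of an orientation `C` of a cycle of even length `2k`: it is `1` if `C` can be
obtained (up to isomorphism) from `D_{2k}` by reversing an even number of edges, and `-1`
otherwise. -/
noncomputable def gamma (C : OrientedGraph V) (k : ℕ) : ℤ :=
  if ∃ R ⊆ (D k).edges, Even R.card ∧
      ∃ f : Fin (2 * k) ≃ V, C = ((D k).reverse R).map f.toEmbedding
  then 1 else -1

/-- The homomorphism density `t(H, G)` of `H` in a finite oriented graph `G`: the probability that
a uniformly random mapping from the vertices of `H` to those of `G` is a homomorphism. -/
noncomputable def homDensity [Fintype V] [Fintype W] (H : OrientedGraph V)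
    (G : OrientedGraph W) : ℝ :=
  (Nat.card {f : V → W // ∀ u v, H.Adj u v → G.Adj (f u) (f v)} : ℝ) / (Nat.card (V → W) : ℝ)

/-- The homomorphism density `t(H, U)` of `H` in a kernel `U`. -/
noncomputable def kernelDensity [Fintype V] (H : OrientedGraph V) (U : I → I → ℝ) : ℝ :=
  ∫ x : V → I, ∏ e ∈ H.edges, U (x e.1) (x e.2)

/-- A sequence of tournaments is quasirandom if the density of every oriented graph `H` in it
converges to the expected density `2^{-‖H‖}` of `H` in a random tournament. -/
def IsQuasirandomSeq {N : ℕ → ℕ} (T : ∀ i, OrientedGraph (Fin (N i))) : Prop :=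
  ∀ (m : ℕ) (H : OrientedGraph (Fin m)),
    Tendsto (fun i => H.homDensity (T i)) atTop (𝓝 ((1 / 2 : ℝ) ^ H.edges.card))

/-- `H` is quasirandom-forcing: a sequence of tournaments (with orders tending to infinity) is
quasirandom if and only if the density of `H` in the sequence converges to `2^{-‖H‖}`. -/
def IsQuasirandomForcing [Fintype V] (H : OrientedGraph V) : Prop :=
  ∀ (N : ℕ → ℕ) (T : ∀ i, OrientedGraph (Fin (N i))),
    Tendsto N atTop atTop → (∀ i, (T i).IsTournament) →
      (IsQuasirandomSeq T ↔
        Tendsto (fun i => H.homDensity (T i)) atTop (𝓝 ((1 / 2 : ℝ) ^ H.edges.card)))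

end OrientedGraph

/-- A tournamenton: a non-negative measurable function on `[0,1]²` with `W(x,y) + W(y,x) = 1`
(boundedness follows). -/
structure IsTournamenton (W : I → I → ℝ) : Prop where
  measurable : Measurable (Function.uncurry W)
  nonneg : ∀ x y, 0 ≤ W x y
  add_swap : ∀ x y, W x y + W y x = 1

/-- `H` is quasirandom-forcing, in the language of tournament limits: every tournamenton `W` with
`t(H, W) = 2^{-‖H‖}` is equal to `1/2` almost everywhere. -/
def OrientedGraph.IsLimitQuasirandomForcing {V : Type*} [Fintype V] (H : OrientedGraph V) : Prop :=
  ∀ W : I → I → ℝ, IsTournamenton W → H.kernelDensity W = (1 / 2 : ℝ) ^ H.edges.card →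
    ∀ᵐ p : I × I, W p.1 p.2 = 1 / 2

/-! ### Integrals over finite powers of a probability space -/

section Power

variable {Ω : Type*} [MeasurableSpace Ω] {μ : Measure Ω}

/-! Write a tournamenton as $W=(1+B)/2$ with $B$ skew-symmetric and $|B|\le 1$. Expanding the
product over the edges gives $t(C,W)=2^{-\|C\|}\sum_{F\subseteq E(C)}t(C[F],B)$, and reversing an
edge changes the sign of a density in $B$. The empty set contributes the expected value
$2^{-\|C\|}$.

A proper nonempty $F$ forms a linear forest. If some component is a path of odd length, reflecting
it reverses an odd number of edges, so the density equals its own negative and vanishes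
(`density_linearForest_eq_zero`). Otherwise the forest is, up to reversals, a union of paths
$Q_{2n_i}$. Its two mirror halves are directed alike, so the density of the union is the integral of
a square (`density_pathUnion_nonneg`). Collecting equal types produces the coefficients $\alpha_C$
(`sum_density_isPathUnion`). The full set contributes $\gamma_C\,t(D_{2k},B)$. Under the sign
hypothesis nothing can cancel this term, whence $2^{-\|C\|}\,t(D_{2k},B)\le|t(C,W)-2^{-\|C\|}|$
(`IsCycleOrientation.density_D_le`).

Finally, $t(D_{2k},B)$ is the squared Hilbert–Schmidt norm of the $k$-th power of the skew-adjoint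
operator of $B$. Repeated Cauchy–Schwarz bounds every bilinear average $\int f(x)B(x,y)g(y)$ by a
root of it (`abs_bilinear_pow_le`). If all these averages vanish, then $B=0$ almost everywhere. If
they are small, every density $t(H,W)$ is close to $2^{-\|H\|}$. The estimates hold over any
probability space, so finite tournaments are treated directly with the uniform measure on their
vertices, at the cost of an error $\|H\|/N$ from the diagonal; no compactness argument is needed. -/

theorem Measurable.integrable_of_abs_le {X : Type*} [MeasurableSpace X] {ν : Measure X}
    [IsFiniteMeasure ν] {f : X → ℝ} (hf : Measurable f) {c : ℝ} (hc : ∀ x, |f x| ≤ c) :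
    Integrable f ν :=
  Integrable.of_bound hf.aestronglyMeasurable c (.of_forall hc)

theorem abs_integral_le_of_abs_le {X : Type*} [MeasurableSpace X] {ν : Measure X}
    [IsProbabilityMeasure ν] {f : X → ℝ} {c : ℝ} (hc : ∀ x, |f x| ≤ c) : |∫ x, f x ∂ν| ≤ c := by
  have := norm_integral_le_of_norm_le_const (μ := ν) (f := f) (.of_forall hc)
  simpa using this

theorem Measurable.integral_right {X Y : Type*} [MeasurableSpace X] [MeasurableSpace Y]
    {ν : Measure Y} [SFinite ν] {f : X → Y → ℝ} (hf : Measurable (Function.uncurry f)) :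
    Measurable fun x => ∫ y, f x y ∂ν :=
  (hf.stronglyMeasurable.integral_prod_right).measurable

/-- Jensen's inequality for the square. -/
theorem sq_integral_le_integral_sq {X : Type*} [MeasurableSpace X] {ν : Measure X}
    [IsProbabilityMeasure ν] {f : X → ℝ} (hf : Measurable f) {c : ℝ} (hc : ∀ x, |f x| ≤ c) :
    (∫ x, f x ∂ν) ^ 2 ≤ ∫ x, f x ^ 2 ∂ν := by
  have h1 : Integrable f ν := hf.integrable_of_abs_le hc
  have h2 : Integrable (fun x => f x ^ 2) ν :=
    (hf.pow_const 2).integrable_of_abs_le (c := c ^ 2) fun x => by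
      rw [abs_pow]; exact pow_le_pow_left₀ (abs_nonneg _) (hc x) 2
  set a := ∫ x, f x ∂ν
  have h3 : 0 ≤ ∫ x, (f x - a) ^ 2 ∂ν := integral_nonneg fun x => sq_nonneg _
  have h4 : ∫ x, (f x - a) ^ 2 ∂ν = (∫ x, f x ^ 2 ∂ν) - 2 * a * a + a ^ 2 := by
    have : ∀ x, (f x - a) ^ 2 = f x ^ 2 - 2 * a * f x + a ^ 2 := fun x => by ring
    simp_rw [this]
    have h5 : Integrable (fun x => 2 * a * f x) ν := h1.const_mul _
    have h6 : Integrable (fun x => f x ^ 2 - 2 * a * f x) ν := h2.sub h5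
    rw [integral_add h6 (integrable_const _), integral_sub h2 h5, integral_const_mul,
      integral_const]
    simp [a]
  nlinarith

theorem measurable_precomp {S V : Type*} (g : S → V) :
    Measurable fun (x : V → Ω) (s : S) => x (g s) :=
  measurable_pi_lambda _ fun _ => measurable_pi_apply _

/-- Forgetting coordinates preserves product measures. -/
theorem measurePreserving_comp_injective {S V : Type*} [Fintype S] [Fintype V]
    [IsProbabilityMeasure μ] {f : S → V} (hf : Function.Injective f) :
    MeasurePreserving (fun x : V → Ω => x ∘ f) (Measure.pi fun _ => μ) (Measure.pi fun _ => μ) := by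
  classical
  have hm : Measurable fun x : V → Ω => x ∘ f := measurable_precomp f
  refine ⟨hm, (Measure.pi_eq fun s hs => ?_).symm⟩
  rw [Measure.map_apply hm (MeasurableSet.univ_pi hs)]
  -- The preimage of a box is a box: the side at `f i` is `s i`, and outside the range of `f` the
  -- condition is vacuous, so the side is the whole space, of measure 1.
  have : (fun x : V → Ω => x ∘ f) ⁻¹' Set.univ.pi s
      = Set.univ.pi fun v => {a | ∀ i, f i = v → a ∈ s i} := by
    ext x
    simp only [Set.mem_preimage, Set.mem_pi, Set.mem_univ, true_imp_iff, Function.comp_apply,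
      Set.mem_ofPred_eq]
    exact ⟨fun h v i hi => hi ▸ h i, fun h i => h _ i rfl⟩
  rw [this, Measure.pi_pi]
  rw [← Finset.prod_subset (Finset.subset_univ (Finset.univ.image f)),
    Finset.prod_image fun a _ b _ h => hf h]
  · refine Finset.prod_congr rfl fun i _ => congrArg μ ?_
    ext a
    simp only [Set.mem_ofPred_eq]
    exact ⟨fun h => h i rfl, fun h j hj => hf hj ▸ h⟩
  · intro v _ hv
    have : {a : Ω | ∀ i, f i = v → a ∈ s i} = Set.univ := by
      ext a
      simp only [Set.mem_ofPred_eq, Set.mem_univ, iff_true]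
      rintro i rfl
      simp at hv
    rw [this, measure_univ]

theorem integral_comp_injective {S V : Type*} [Fintype S] [Fintype V]
    [IsProbabilityMeasure μ] {f : S → V} (hf : Function.Injective f) {G : (S → Ω) → ℝ}
    (hG : Measurable G) :
    ∫ x : V → Ω, G (x ∘ f) ∂(Measure.pi fun _ => μ) = ∫ y, G y ∂(Measure.pi fun _ => μ) := by
  have h := measurePreserving_comp_injective (μ := μ) hf
  rw [← h.map_eq, integral_map h.measurable.aemeasurable hG.aestronglyMeasurable]

theorem integral_sum_pi {S T : Type*} [Fintype S] [Fintype T] [IsProbabilityMeasure μ]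
    {G : (S → Ω) → (T → Ω) → ℝ} (hG : Measurable (Function.uncurry G)) {c : ℝ}
    (hc : ∀ x y, |G x y| ≤ c) :
    ∫ x : S ⊕ T → Ω, G (x ∘ Sum.inl) (x ∘ Sum.inr) ∂(Measure.pi fun _ => μ)
      = ∫ y, ∫ z, G y z ∂(Measure.pi fun _ => μ) ∂(Measure.pi fun _ => μ) := by
  have h := measurePreserving_sumPiEquivProdPi (X := fun _ : S ⊕ T => Ω) (fun _ => μ)
  have h2 := h.integral_comp' (g := Function.uncurry G)
  have h3 := integral_prod (μ := Measure.pi fun _ : S => μ) (ν := Measure.pi fun _ : T => μ)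
    (Function.uncurry G) (hG.integrable_of_abs_le (c := c) fun p => hc p.1 p.2)
  exact h2.trans h3

/-- Gluing two copies of a structure along common vertices squares its conditional density. -/
theorem integral_glue {Z L V : Type*} [Fintype Z] [Fintype L] [Fintype V] [IsProbabilityMeasure μ]
    {f : Z ⊕ (L ⊕ L) → V} (hf : Function.Injective f) {G : (Z → Ω) → (L → Ω) → ℝ}
    (hG : Measurable (Function.uncurry G)) (hc : ∀ x y, |G x y| ≤ 1) :
    ∫ x : V → Ω, G (fun z => x (f (.inl z))) (fun l => x (f (.inr (.inl l)))) *
        G (fun z => x (f (.inl z))) (fun l => x (f (.inr (.inr l)))) ∂(Measure.pi fun _ => μ)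
      = ∫ z, (∫ l, G z l ∂(Measure.pi fun _ => μ)) ^ 2 ∂(Measure.pi fun _ => μ) := by
  have hmul : ∀ x y z, |G x y * G x z| ≤ 1 := fun x y z => by
    rw [abs_mul]; exact mul_le_one₀ (hc _ _) (abs_nonneg _) (hc _ _)
  have hm : Measurable fun p : (Z → Ω) × (L ⊕ L → Ω) =>
      G p.1 (fun l => p.2 (.inl l)) * G p.1 (fun l => p.2 (.inr l)) :=
    (hG.comp (measurable_fst.prodMk ((measurable_precomp Sum.inl).comp measurable_snd))).mul
      (hG.comp (measurable_fst.prodMk ((measurable_precomp Sum.inr).comp measurable_snd)))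
  have e1 := integral_comp_injective (μ := μ) hf (G := fun x : Z ⊕ (L ⊕ L) → Ω =>
      G (x ∘ Sum.inl) (fun l => (x ∘ Sum.inr) (.inl l)) *
        G (x ∘ Sum.inl) (fun l => (x ∘ Sum.inr) (.inr l)))
      (hm.comp ((measurable_precomp Sum.inl).prodMk (measurable_precomp Sum.inr)) :)
  have e2 := integral_sum_pi (μ := μ) (G := fun (z : Z → Ω) (w : L ⊕ L → Ω) =>
      G z (fun l => w (.inl l)) * G z (fun l => w (.inr l))) hm (fun _ _ => hmul _ _ _)
  refine e1.trans (e2.trans (integral_congr_ae (.of_forall fun z => ?_)))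
  -- For fixed `z` the two copies depend on disjoint sets of coordinates, so the inner integral
  -- factors.
  have hz : Measurable (G z) := hG.comp measurable_prodMk_left
  have e3 := integral_sum_pi (μ := μ) (G := fun (l l' : L → Ω) => G z l * G z l')
    ((hz.comp measurable_fst).mul (hz.comp measurable_snd)) (fun _ _ => hmul _ _ _)
  refine e3.trans ?_
  simp_rw [integral_const_mul, integral_mul_const]
  exact (sq _).symm

end Power

/-- A measurable kernel with values in `[-1, 1]` that is skew-symmetric. -/
structure IsSkewKernel {Ω : Type*} [MeasurableSpace Ω] (B : Ω → Ω → ℝ) : Prop where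
  measurable : Measurable (Function.uncurry B)
  abs_le : ∀ x y, |B x y| ≤ 1
  swap : ∀ x y, B x y = -B y x

theorem abs_prod_le_one {ι : Type*} {s : Finset ι} {f : ι → ℝ} (h : ∀ i ∈ s, |f i| ≤ 1) :
    |∏ i ∈ s, f i| ≤ 1 := by
  rw [Finset.abs_prod]
  exact Finset.prod_le_one (fun _ _ => abs_nonneg _) h

/-! ### Densities of oriented graphs in skew-symmetric kernels -/

namespace OrientedGraph

variable {V W : Type*}

@[ext]
theorem ext_adj {G H : OrientedGraph V} (h : ∀ u v, G.Adj u v ↔ H.Adj u v) : G = H := by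
  obtain ⟨⟨A⟩, _⟩ := G
  obtain ⟨⟨A'⟩, _⟩ := H
  have : A = A' := funext fun u => funext fun v => propext (h u v)
  subst this
  rfl

/-- Two vertices are joined by an edge, in one of the two directions. -/
def Joined (H : OrientedGraph V) (u v : V) : Prop := H.Adj u v ∨ H.Adj v u

theorem Joined.symm {H : OrientedGraph V} {u v : V} (h : H.Joined u v) : H.Joined v u := Or.symm h

theorem not_adj_self (H : OrientedGraph V) (v : V) : ¬ H.Adj v v := fun h => H.asymm v v h h

theorem Joined.ne {H : OrientedGraph V} {u v : V} (h : H.Joined u v) : u ≠ v := by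
  rintro rfl
  exact h.elim (H.not_adj_self u) (H.not_adj_self u)

@[simp]
theorem mem_edges [Fintype V] {H : OrientedGraph V} {e : V × V} :
    e ∈ H.edges ↔ H.Adj e.1 e.2 := by
  simp [edges]

theorem spanning_edges [Fintype V] (H : OrientedGraph V) : H.spanning H.edges = H := by
  ext u v
  exact ⟨fun h => h.1, fun h => ⟨h, mem_edges.2 h⟩⟩

theorem edges_spanning [Fintype V] {H : OrientedGraph V} {F : Finset (V × V)} (hF : F ⊆ H.edges) :
    (H.spanning F).edges = F := by
  ext e
  rw [mem_edges]
  exact ⟨fun h => h.2, fun h => ⟨mem_edges.1 (hF h), h⟩⟩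

theorem edges_map [Fintype V] [Fintype W] (H : OrientedGraph V) (f : V ↪ W) :
    (H.map f).edges = H.edges.map (f.prodMap f) := by
  ext ⟨a, b⟩
  simp only [mem_edges, map, Finset.mem_map, Function.Embedding.prodMap, Prod.exists,
    Function.Embedding.coeFn_mk, Prod.map_apply, Prod.mk.injEq]

section Density

variable {Ω : Type*} [MeasurableSpace Ω] (μ : Measure Ω) {B : Ω → Ω → ℝ}

/-- The homomorphism density of `H` in a kernel on an arbitrary measure space. -/
noncomputable def density [Fintype V] (H : OrientedGraph V) (U : Ω → Ω → ℝ) : ℝ :=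
  ∫ x : V → Ω, ∏ e ∈ H.edges, U (x e.1) (x e.2) ∂(Measure.pi fun _ => μ)

theorem measurable_prod_kernel {X ι : Type*} [MeasurableSpace X]
    {U : Ω → Ω → ℝ} (hU : Measurable (Function.uncurry U)) (s : Finset ι) {a b : X → ι → Ω}
    (ha : ∀ i, Measurable fun x => a x i) (hb : ∀ i, Measurable fun x => b x i) :
    Measurable fun x : X => ∏ i ∈ s, U (a x i) (b x i) :=
  Finset.measurable_prod s fun i _ => hU.comp ((ha i).prodMk (hb i))

theorem measurable_prod_edges {U : Ω → Ω → ℝ} (hU : Measurable (Function.uncurry U))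
    (s : Finset (V × V)) : Measurable fun x : V → Ω => ∏ e ∈ s, U (x e.1) (x e.2) :=
  measurable_prod_kernel (a := fun (x : V → Ω) (e : V × V) => x e.1) (b := fun x e => x e.2) hU s
    (fun _ => measurable_pi_apply _) (fun _ => measurable_pi_apply _)

variable {μ} [IsProbabilityMeasure μ]

theorem density_map [Fintype V] [Fintype W] (H : OrientedGraph V) (f : V ↪ W) {U : Ω → Ω → ℝ}
    (hU : Measurable (Function.uncurry U)) : (H.map f).density μ U = H.density μ U := by
  have := integral_comp_injective (μ := μ) f.injective (measurable_prod_edges hU H.edges)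
  rw [density, density, ← this]
  refine integral_congr_ae (.of_forall fun x => ?_)
  simp only [edges_map, Finset.prod_map]
  rfl

omit [IsProbabilityMeasure μ] in
-- Each reversed edge swaps the two arguments of its factor, which costs a factor $-1$.
theorem density_reverse [Fintype V] (H : OrientedGraph V) {R : Finset (V × V)} (hR : R ⊆ H.edges)
    (hB : IsSkewKernel B) : (H.reverse R).density μ B = (-1) ^ R.card * H.density μ B := by
  classical
  rw [density, density, ← integral_const_mul]
  refine integral_congr_ae (.of_forall fun x => ?_)
  have h1 : ∏ e ∈ (H.reverse R).edges, B (x e.1) (x e.2)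
      = ∏ e ∈ H.edges, (if e ∈ R then -1 else 1) * B (x e.1) (x e.2) := by
    refine (Finset.prod_bij (fun e _ => if e ∈ R then e.swap else e) ?_ ?_ ?_ ?_).symm
    · rintro ⟨u, v⟩ he
      rw [mem_edges] at he ⊢
      by_cases h : (u, v) ∈ R
      · rw [if_pos h]; exact .inr ⟨he, h⟩
      · rw [if_neg h]; exact .inl ⟨he, h⟩
    · rintro ⟨u, v⟩ he ⟨u', v'⟩ he' h
      rw [mem_edges] at he he'
      have := H.asymm u v he
      split_ifs at h
      · exact Prod.swap_injective h
      · simp only [Prod.swap_prod_mk, Prod.mk.injEq] at h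
        rw [← h.1, ← h.2] at he'; exact absurd he' this
      · simp only [Prod.swap_prod_mk, Prod.mk.injEq] at h
        rw [h.1, h.2] at this; exact absurd he' this
      · exact h
    · rintro ⟨u, v⟩ he
      rw [mem_edges] at he
      rcases he with he | he
      · exact ⟨(u, v), mem_edges.2 he.1, if_neg he.2⟩
      · exact ⟨(v, u), mem_edges.2 he.1, if_pos he.2⟩
    · rintro ⟨u, v⟩ he
      split_ifs
      · simp [hB.swap (x u)]
      · simp
  have h2 : ∏ e ∈ H.edges, (if e ∈ R then (-1 : ℝ) else 1) = (-1) ^ R.card := by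
    rw [Finset.prod_ite_mem, Finset.inter_eq_right.2 hR, Finset.prod_const]
  simp only [h1, Finset.prod_mul_distrib, h2]

theorem _root_.IsSkewKernel.abs_prod_le (hB : IsSkewKernel B) {ι : Type*} (s : Finset ι) (a b : ι → Ω) :
    |∏ i ∈ s, B (a i) (b i)| ≤ 1 :=
  abs_prod_le_one fun _ _ => hB.abs_le _ _

/-- Expansion of the density in `(1 + B) / 2` over the spanning subgraphs. -/
theorem density_half_one_add [Fintype V] (H : OrientedGraph V) (hB : IsSkewKernel B) :
    H.density μ (fun x y => (1 + B x y) / 2)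
      = (1 / 2) ^ H.edges.card * ∑ F ∈ H.edges.powerset, (H.spanning F).density μ B := by
  classical
  have h1 : ∀ F ∈ H.edges.powerset, (H.spanning F).density μ B
      = ∫ x : V → Ω, ∏ e ∈ F, B (x e.1) (x e.2) ∂(Measure.pi fun _ => μ) := fun F hF => by
    rw [density, edges_spanning (Finset.mem_powerset.1 hF)]
  rw [Finset.sum_congr rfl h1, ← integral_finsetSum, ← integral_const_mul, density]
  · refine integral_congr_ae (.of_forall fun x => ?_)
    have : ∀ e : V × V, (1 + B (x e.1) (x e.2)) / 2 = (1 / 2) * (1 + B (x e.1) (x e.2)) :=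
      fun e => by ring
    simp only [this]
    rw [Finset.prod_mul_distrib, Finset.prod_const, Finset.prod_one_add]
  · intro F _
    exact (measurable_prod_edges hB.measurable F).integrable_of_abs_le
      fun x => IsSkewKernel.abs_prod_le hB _ _ _

theorem density_spanning_empty [Fintype V] (H : OrientedGraph V) (U : Ω → Ω → ℝ) :
    (H.spanning ∅).density μ U = 1 := by
  rw [density, edges_spanning (Finset.empty_subset _)]
  simp

/-- Freeze all vertices other than `u` and `v`. No edge besides `(u, v)` contains both, so the
product takes the form $f(s)B(s,t)g(t)$ and the hypothesis on bilinear averages applies. The map `φ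
s t` is the assignment placing `u` at `s` and `v` at `t`. -/
theorem abs_integral_prod_edges_le [Fintype V] (H : OrientedGraph V) (hB : IsSkewKernel B) {ε : ℝ}
    (hε : ∀ f g : Ω → ℝ, Measurable f → Measurable g → (∀ x, |f x| ≤ 1) → (∀ x, |g x| ≤ 1) →
      |∫ p, f p.1 * B p.1 p.2 * g p.2 ∂(μ.prod μ)| ≤ ε) {u v : V} (huv : H.Adj u v)
    {φ : Ω → Ω → V → Ω} (hφu : ∀ s t, φ s t u = s) (hφv : ∀ s t, φ s t v = t)
    (hφ1 : ∀ s t t' w, w ≠ v → φ s t w = φ s t' w)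
    (hφ2 : ∀ s s' t w, w ≠ u → φ s t w = φ s' t w)
    (hφm : ∀ w, Measurable fun p : Ω × Ω => φ p.1 p.2 w) :
    |∫ p : Ω × Ω, ∏ e ∈ H.edges, B (φ p.1 p.2 e.1) (φ p.1 p.2 e.2) ∂(μ.prod μ)| ≤ ε := by
  classical
  have he : (u, v) ∈ H.edges := mem_edges.2 huv
  have hne : u ≠ v := fun h => H.not_adj_self v (h ▸ huv)
  -- A dummy value for the coordinate on which a factor does not depend.
  obtain ⟨o⟩ : Nonempty Ω := nonempty_of_isProbabilityMeasure μ
  have hm1 : ∀ w, Measurable fun s => φ s o w := fun w =>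
    (hφm w).comp (measurable_id.prodMk measurable_const : Measurable fun s : Ω => (s, o))
  have hm2 : ∀ w, Measurable fun t => φ o t w := fun w =>
    (hφm w).comp (measurable_const.prodMk measurable_id : Measurable fun t : Ω => (o, t))
  generalize hE : H.edges.erase (u, v) = E
  have hsplit : ∀ p : Ω × Ω, ∏ e ∈ H.edges, B (φ p.1 p.2 e.1) (φ p.1 p.2 e.2)
      = (∏ e ∈ E.filter fun e => e.1 ≠ v ∧ e.2 ≠ v, B (φ p.1 o e.1) (φ p.1 o e.2)) *
        B p.1 p.2 * ∏ e ∈ E.filter fun e => ¬ (e.1 ≠ v ∧ e.2 ≠ v), B (φ o p.2 e.1) (φ o p.2 e.2) := by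
    intro p
    rw [← Finset.mul_prod_erase _ _ he, hE, ← Finset.prod_filter_mul_prod_filter_not E
      (fun e => e.1 ≠ v ∧ e.2 ≠ v)]
    have h1 : ∏ e ∈ E.filter (fun e => e.1 ≠ v ∧ e.2 ≠ v), B (φ p.1 p.2 e.1) (φ p.1 p.2 e.2)
        = ∏ e ∈ E.filter (fun e => e.1 ≠ v ∧ e.2 ≠ v), B (φ p.1 o e.1) (φ p.1 o e.2) :=
      Finset.prod_congr rfl fun e h => by
        have := (Finset.mem_filter.1 h).2
        rw [hφ1 p.1 p.2 o _ this.1, hφ1 p.1 p.2 o _ this.2]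
    have h2 : ∏ e ∈ E.filter (fun e => ¬ (e.1 ≠ v ∧ e.2 ≠ v)), B (φ p.1 p.2 e.1) (φ p.1 p.2 e.2)
        = ∏ e ∈ E.filter (fun e => ¬ (e.1 ≠ v ∧ e.2 ≠ v)), B (φ o p.2 e.1) (φ o p.2 e.2) :=
      Finset.prod_congr rfl fun e h => by
        obtain ⟨h3, h4⟩ := Finset.mem_filter.1 h
        obtain ⟨h5, h6⟩ := Finset.mem_erase.1 (hE ▸ h3)
        rw [mem_edges] at h6
        -- An edge meeting both `u` and `v` would be `(u, v)`, which was erased, or `(v, u)`, which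
        -- asymmetry excludes.
        have h7 : e.1 ≠ u ∧ e.2 ≠ u := by
          refine ⟨fun h => h4 ⟨h ▸ hne, fun hb => h5 (Prod.ext h hb)⟩,
            fun h => h4 ⟨fun ha => H.asymm _ _ huv ?_, h ▸ hne⟩⟩
          rwa [h, ha] at h6
        rw [hφ2 p.1 o p.2 _ h7.1, hφ2 p.1 o p.2 _ h7.2]
    rw [h1, h2, hφu, hφv]
    ring
  simp only [hsplit]
  generalize E.filter (fun e => e.1 ≠ v ∧ e.2 ≠ v) = E₁
  generalize E.filter (fun e => ¬ (e.1 ≠ v ∧ e.2 ≠ v)) = E₂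
  have hf := measurable_prod_kernel (a := fun s (e : V × V) => φ s o e.1)
      (b := fun s (e : V × V) => φ s o e.2) hB.measurable E₁
      (fun e => hm1 e.1) (fun e => hm1 e.2)
  have hg := measurable_prod_kernel (a := fun t (e : V × V) => φ o t e.1)
      (b := fun t (e : V × V) => φ o t e.2) hB.measurable E₂
      (fun e => hm2 e.1) (fun e => hm2 e.2)
  exact hε _ _ hf hg (fun s => hB.abs_prod_le _ (fun (e : V × V) => φ s o e.1) (fun (e : V × V) => φ s o e.2))
    (fun t => hB.abs_prod_le _ (fun (e : V × V) => φ o t e.1) (fun (e : V × V) => φ o t e.2))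

/-- If all bilinear averages of `B` are small, so are all densities of graphs with an edge. -/
theorem abs_density_le [Fintype V] (H : OrientedGraph V) (hB : IsSkewKernel B) {ε : ℝ}
    (hε : ∀ f g : Ω → ℝ, Measurable f → Measurable g → (∀ x, |f x| ≤ 1) → (∀ x, |g x| ≤ 1) →
      |∫ p, f p.1 * B p.1 p.2 * g p.2 ∂(μ.prod μ)| ≤ ε) (hH : H.edges.Nonempty) :
    |H.density μ B| ≤ ε := by
  classical
  obtain ⟨⟨u, v⟩, he⟩ := hH
  have huv : H.Adj u v := mem_edges.1 he
  have hne : u ≠ v := fun h => H.not_adj_self v (h ▸ huv)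
  -- Moves `u` and `v` into a separate block of two coordinates, to be integrated first. The
  -- coordinates `.inl u` and `.inl v` become idle, which is harmless because only injectivity is
  -- needed.
  set ψ : V → V ⊕ Fin 2 := fun w => if w = u then .inr 0 else if w = v then .inr 1 else .inl w
    with hψ
  have hinj : Function.Injective ψ := by
    intro a b h
    simp only [hψ] at h
    split_ifs at h <;> simp_all
  have hm := measurable_prod_edges hB.measurable H.edges
  rw [density, ← integral_comp_injective hinj hm]
  have e2 := integral_sum_pi (μ := μ) (S := V) (T := Fin 2)
    (G := fun y z => ∏ e ∈ H.edges, B (Sum.elim y z (ψ e.1)) (Sum.elim y z (ψ e.2)))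
    (measurable_prod_kernel hB.measurable _
      (fun e => by
        rcases ψ e.1 with w | w
        · exact (measurable_pi_apply w).comp measurable_fst
        · exact (measurable_pi_apply w).comp measurable_snd)
      (fun e => by
        rcases ψ e.2 with w | w
        · exact (measurable_pi_apply w).comp measurable_fst
        · exact (measurable_pi_apply w).comp measurable_snd))
    (fun _ _ => IsSkewKernel.abs_prod_le hB _ _ _)
  have e3 : ∀ x : V ⊕ Fin 2 → Ω, Sum.elim (x ∘ Sum.inl) (x ∘ Sum.inr) = x := fun x =>
    Sum.elim_comp_inl_inr x
  simp only [e3] at e2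
  refine (congrArg abs e2).trans_le (abs_integral_le_of_abs_le fun y => ?_)
  have e4 := (measurePreserving_finTwoArrow μ).integral_comp' (g := fun p : Ω × Ω =>
    ∏ e ∈ H.edges, B (Sum.elim y ![p.1, p.2] (ψ e.1)) (Sum.elim y ![p.1, p.2] (ψ e.2)))
  have e5 : ∀ z : Fin 2 → Ω, ![(MeasurableEquiv.finTwoArrow z).1, (MeasurableEquiv.finTwoArrow z).2]
      = z := fun z => by
    ext i; fin_cases i <;> rfl
  simp only [e5] at e4
  rw [e4]
  set φ : Ω → Ω → V → Ω := fun s t w => Sum.elim y ![s, t] (ψ w) with hφ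
  have hφu : ∀ s t, φ s t u = s := fun s t => by simp [hφ, hψ]
  have hφv : ∀ s t, φ s t v = t := fun s t => by simp [hφ, hψ, hne.symm]
  have hφ1 : ∀ s t t' w, w ≠ v → φ s t w = φ s t' w := fun s t t' w hw => by
    simp only [hφ, hψ, if_neg hw]; split_ifs <;> rfl
  have hφ2 : ∀ s s' t w, w ≠ u → φ s t w = φ s' t w := fun s s' t w hw => by
    simp only [hφ, hψ, if_neg hw]; split_ifs <;> rfl
  have hφm : ∀ w, Measurable fun p : Ω × Ω => φ p.1 p.2 w := fun w => by
    by_cases h1 : w = u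
    · subst h1; simpa only [hφu] using measurable_fst
    by_cases h2 : w = v
    · subst h2; simpa only [hφv] using measurable_snd
    · simp only [hφ, hψ, if_neg h1, if_neg h2]
      exact measurable_const
  exact abs_integral_prod_edges_le H hB hε huv hφu hφv hφ1 hφ2 hφm

end Density
end OrientedGraph

namespace OrientedGraph

variable {V W : Type*}

/-! ### Reversing edges -/

/-- `H` is, up to isolated vertices and the directions of its edges, the image of `G` under `f`. -/
def IsReorientedImage (G : OrientedGraph V) (f : V ↪ W) (H : OrientedGraph W) : Prop :=
  ∀ x y, H.Joined x y ↔ ∃ u v, G.Joined u v ∧ f u = x ∧ f v = y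

theorem joined_reverse (G : OrientedGraph V) {R : Finset (V × V)} (u v : V) :
    (G.reverse R).Joined u v ↔ G.Joined u v := by
  simp only [Joined, reverse]
  tauto

theorem isReorientedImage_map_reverse (G : OrientedGraph V) (f : V ↪ W) (R : Finset (V × V)) :
    G.IsReorientedImage f ((G.reverse R).map f) := by
  intro x y
  constructor
  · rintro (⟨u, v, h, rfl, rfl⟩ | ⟨u, v, h, rfl, rfl⟩)
    · exact ⟨u, v, (joined_reverse G u v).1 (.inl h), rfl, rfl⟩
    · exact ⟨v, u, (joined_reverse G v u).1 (.inr h), rfl, rfl⟩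
  · rintro ⟨u, v, h, rfl, rfl⟩
    rcases (joined_reverse G (R := R) u v).2 h with h | h
    · exact .inl ⟨u, v, h, rfl, rfl⟩
    · exact .inr ⟨v, u, h, rfl, rfl⟩

theorem IsReorientedImage.joined {G : OrientedGraph V} {f : V ↪ W} {H : OrientedGraph W}
    (h : G.IsReorientedImage f H) (u v : V) : H.Joined (f u) (f v) ↔ G.Joined u v := by
  rw [h]
  constructor
  · rintro ⟨u', v', h', hu, hv⟩
    rwa [← f.injective hu, ← f.injective hv]
  · exact fun h' => ⟨u, v, h', rfl, rfl⟩

/-- Both graphs orient the same underlying edges, so `R` consists of the edges on which they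
disagree. -/
theorem IsReorientedImage.exists_reverse [Fintype V] {G : OrientedGraph V} {f : V ↪ W}
    {H : OrientedGraph W} (h : G.IsReorientedImage f H) :
    ∃ R ⊆ G.edges, H = (G.reverse R).map f := by
  classical
  refine ⟨G.edges.filter fun e => H.Adj (f e.2) (f e.1), Finset.filter_subset _ _, ?_⟩
  ext x y
  simp only [map, reverse, Finset.mem_filter, mem_edges]
  constructor
  · intro hxy
    obtain ⟨u, v, huv, rfl, rfl⟩ := (h x y).1 (.inl hxy)
    have := H.asymm _ _ hxy
    refine ⟨u, v, ?_, rfl, rfl⟩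
    rcases huv with huv | huv
    · exact .inl ⟨huv, fun h' => this h'.2⟩
    · exact .inr ⟨huv, huv, hxy⟩
  · rintro ⟨u, v, h', rfl, rfl⟩
    rcases h' with ⟨h1, h2⟩ | ⟨h1, h2⟩
    · rcases (h.joined u v).2 (.inl h1) with h3 | h3
      · exact h3
      · exact absurd ⟨h1, h3⟩ h2
    · exact h2.2

section Density

variable {Ω : Type*} [MeasurableSpace Ω] {μ : Measure Ω} [IsProbabilityMeasure μ] {B : Ω → Ω → ℝ}

theorem density_map_reverse [Fintype V] [Fintype W] (G : OrientedGraph V) (f : V ↪ W)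
    {R : Finset (V × V)} (hR : R ⊆ G.edges) (hB : IsSkewKernel B) :
    ((G.reverse R).map f).density μ B = (-1) ^ R.card * G.density μ B := by
  rw [density_map _ _ hB.measurable, density_reverse _ hR hB]

theorem prod_edges_eq [Fintype V] {H : OrientedGraph V} {ι : Type*} [Fintype ι] {g : ι → V × V}
    (hg : Function.Injective g) (h : ∀ u v, H.Adj u v ↔ ∃ i, g i = (u, v)) (F : V × V → ℝ) :
    ∏ e ∈ H.edges, F e = ∏ i, F (g i) := by
  have : H.edges = Finset.univ.map ⟨g, hg⟩ := by
    ext ⟨u, v⟩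
    simp [h]
  rw [this, Finset.prod_map]
  rfl

/-! ### Disjoint unions of paths -/

theorem joined_Q (n : ℕ) (i j : Fin (2 * n + 1)) :
    (Q n).Joined i j ↔ j.val = i.val + 1 ∨ i.val = j.val + 1 := by
  simp only [Joined, Q]
  omega

theorem joined_disjointUnion {ι : Type*} {X : ι → Type*} (H : ∀ i, OrientedGraph (X i))
    (p q : Σ i, X i) :
    (disjointUnion H).Joined p q ↔ ∃ i a b, (H i).Joined a b ∧ p = ⟨i, a⟩ ∧ q = ⟨i, b⟩ := by
  constructor
  · rintro (⟨i, a, b, h, rfl, rfl⟩ | ⟨i, a, b, h, rfl, rfl⟩)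
    · exact ⟨i, a, b, .inl h, rfl, rfl⟩
    · exact ⟨i, b, a, .inr h, rfl, rfl⟩
  · rintro ⟨i, a, b, h | h, rfl, rfl⟩
    · exact .inl ⟨i, a, b, h, rfl, rfl⟩
    · exact .inr ⟨i, b, a, h, rfl, rfl⟩

/-- The disjoint union of the paths `Q_{2n_i}`. -/
abbrev pathUnion {ι : Type*} (n : ι → ℕ) : OrientedGraph (Σ i, Fin (2 * n i + 1)) :=
  disjointUnion fun i => Q (n i)

/-- The edges split into two mirror families, each indexed by the path and the distance of the tail
from its centre. -/
theorem prod_edges_pathUnion {ι : Type*} [Fintype ι] (n : ι → ℕ)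
    (F : (Σ i, Fin (2 * n i + 1)) × (Σ i, Fin (2 * n i + 1)) → ℝ) :
    ∏ e ∈ (pathUnion n).edges, F e
      = (∏ p : Σ i, Fin (n i), F (⟨p.1, ⟨n p.1 + p.2, by omega⟩⟩, ⟨p.1, ⟨n p.1 + p.2 + 1, by omega⟩⟩)) *
        ∏ p : Σ i, Fin (n i), F (⟨p.1, ⟨n p.1 - p.2, by omega⟩⟩, ⟨p.1, ⟨n p.1 - (p.2 + 1), by omega⟩⟩) := by
  rw [prod_edges_eq (ι := (Σ i, Fin (n i)) ⊕ (Σ i, Fin (n i))) (g := Sum.elim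
    (fun p => (⟨p.1, ⟨n p.1 + p.2, by omega⟩⟩, ⟨p.1, ⟨n p.1 + p.2 + 1, by omega⟩⟩))
    (fun p => (⟨p.1, ⟨n p.1 - p.2, by omega⟩⟩, ⟨p.1, ⟨n p.1 - (p.2 + 1), by omega⟩⟩)))]
  · rw [Fintype.prod_sum_type]
    rfl
  · rintro (⟨i, a⟩ | ⟨i, a⟩) (⟨j, b⟩ | ⟨j, b⟩) h <;>
      · simp only [Sum.elim_inl, Sum.elim_inr, Prod.mk.injEq, Sigma.mk.injEq] at h
        obtain ⟨⟨rfl, h1⟩, -, h2⟩ := h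
        rw [heq_eq_eq, Fin.mk.injEq] at h1 h2
        have ha := a.isLt
        have hb := b.isLt
        first
        | (exfalso; omega)
        | rw [show a = b from Fin.ext (by omega)]
  · intro u v
    constructor
    · rintro ⟨i, a, b, h, rfl, rfl⟩
      have ha := a.isLt
      have hb := b.isLt
      rcases h with ⟨h1, h2⟩ | ⟨h1, h2⟩
      · refine ⟨.inl ⟨i, ⟨a - n i, by omega⟩⟩, ?_⟩
        simp only [Sum.elim_inl, Prod.mk.injEq, Sigma.mk.injEq, heq_eq_eq, true_and]
        constructor <;> ext <;> dsimp only <;> omega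
      · refine ⟨.inr ⟨i, ⟨n i - a, by omega⟩⟩, ?_⟩
        simp only [Sum.elim_inr, Prod.mk.injEq, Sigma.mk.injEq, heq_eq_eq, true_and]
        constructor <;> ext <;> dsimp only <;> omega
    · rintro ⟨⟨i, a⟩ | ⟨i, a⟩, h⟩
      · simp only [Sum.elim_inl, Prod.mk.injEq] at h
        exact ⟨i, _, _, .inl ⟨by dsimp only; omega, by dsimp only⟩, h.1.symm, h.2.symm⟩
      · simp only [Sum.elim_inr, Prod.mk.injEq] at h
        have := a.isLt
        exact ⟨i, _, _, .inr ⟨by dsimp only; omega, by dsimp only; omega⟩, h.1.symm, h.2.symm⟩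

/-- The two arms of each path leave the centre with the same orientation. Hence the union is two
copies of one graph glued along the centres, and its density is the integral of a square. -/
theorem density_pathUnion_nonneg {ι : Type*} [Fintype ι] (n : ι → ℕ) (hB : IsSkewKernel B) :
    0 ≤ (pathUnion n).density μ B := by
  -- The vertex at distance `a` from the centre along an arm of path `i`. The centre `z i` is the
  -- intended value at `a = 0` and a junk value for `a > n i`, which is never used.
  set w : (ι → Ω) → ((Σ i, Fin (n i)) → Ω) → ι → ℕ → Ω := fun z l i a =>
    if h : 0 < a ∧ a - 1 < n i then l ⟨i, ⟨a - 1, h.2⟩⟩ else z i with hw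
  have hwm : ∀ i a, Measurable fun p : (ι → Ω) × ((Σ i, Fin (n i)) → Ω) => w p.1 p.2 i a := by
    intro i a
    simp only [hw]
    split_ifs
    · exact (measurable_pi_apply _).comp measurable_snd
    · exact (measurable_pi_apply _).comp measurable_fst
  set f : ι ⊕ ((Σ i, Fin (n i)) ⊕ (Σ i, Fin (n i))) → Σ i, Fin (2 * n i + 1) := Sum.elim
    (fun i => ⟨i, ⟨n i, by omega⟩⟩) (Sum.elim (fun p => ⟨p.1, ⟨n p.1 + p.2 + 1, by omega⟩⟩)
      (fun p => ⟨p.1, ⟨n p.1 - (p.2 + 1), by omega⟩⟩)) with hf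
  have hinj : Function.Injective f := by
    rintro (i | ⟨i, a⟩ | ⟨i, a⟩) (j | ⟨j, b⟩ | ⟨j, b⟩) h <;>
      · simp only [hf, Sum.elim_inl, Sum.elim_inr, Sigma.mk.injEq] at h
        obtain ⟨rfl, h1⟩ := h
        rw [heq_eq_eq, Fin.mk.injEq] at h1
        all_goals first
        | (exfalso; omega)
        | rw [show a = b from Fin.ext (by omega)]
  set G : (ι → Ω) → ((Σ i, Fin (n i)) → Ω) → ℝ := fun z l =>
    ∏ p : Σ i, Fin (n i), B (w z l p.1 p.2) (w z l p.1 (p.2 + 1)) with hG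
  have hGm : Measurable (Function.uncurry G) :=
    measurable_prod_kernel hB.measurable _ (fun p => hwm p.1 p.2) (fun p => hwm p.1 (p.2 + 1))
  have hGb : ∀ z l, |G z l| ≤ 1 := fun z l =>
    hB.abs_prod_le _ (fun p : Σ i, Fin (n i) => w z l p.1 p.2) (fun p => w z l p.1 (p.2 + 1))
  have key := integral_glue (μ := μ) hinj hGm hGb
  have h0 : ∀ x : (Σ i, Fin (2 * n i + 1)) → Ω,
      ∏ e ∈ (pathUnion n).edges, B (x e.1) (x e.2)
        = G (fun z => x (f (.inl z))) (fun l => x (f (.inr (.inl l)))) *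
          G (fun z => x (f (.inl z))) (fun l => x (f (.inr (.inr l)))) := by
    intro x
    rw [prod_edges_pathUnion n fun e => B (x e.1) (x e.2)]
    have h1 : ∀ i (a : ℕ) (ha : a ≤ n i), w (fun z => x (f (.inl z)))
        (fun l => x (f (.inr (.inl l)))) i a = x ⟨i, ⟨n i + a, by omega⟩⟩ := by
      intro i a ha
      simp only [hw, hf, Sum.elim_inl, Sum.elim_inr]
      split_ifs with h
      · congr 3; omega
      · congr 3; omega
    have h2 : ∀ i (a : ℕ) (ha : a ≤ n i), w (fun z => x (f (.inl z)))
        (fun l => x (f (.inr (.inr l)))) i a = x ⟨i, ⟨n i - a, by omega⟩⟩ := by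
      intro i a ha
      simp only [hw, hf, Sum.elim_inl, Sum.elim_inr]
      split_ifs with h
      · congr 3; omega
      · congr 3; omega
    congr 1 <;> refine Finset.prod_congr rfl fun p _ => ?_
    · rw [h1 _ _ (by omega), h1 _ _ (by omega)]
      rfl
    · rw [h2 _ _ (by omega), h2 _ _ (by omega)]
  simp only [density, h0]
  rw [key]
  exact integral_nonneg fun _ => sq_nonneg _

/-! ### The cycle `D_{2k}` -/

/-- The vertices of a path from `x` to `y` with inner vertices `l`. -/
def walk {α : Type*} {j : ℕ} (x : α) (l : Fin j → α) (y : α) (i : ℕ) : α :=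
  if i = 0 then x else if h : i - 1 < j then l ⟨i - 1, h⟩ else y

theorem walk_zero {α : Type*} {j : ℕ} (x : α) (l : Fin j → α) (y : α) : walk x l y 0 = x := rfl

theorem walk_succ {α : Type*} {j : ℕ} (x : α) (l : Fin (j + 1) → α) (y : α) (i : ℕ) :
    walk x l y (i + 1) = walk (l 0) (fun a => l a.succ) y i := by
  rcases i with _ | i
  · simp [walk]
  · simp only [walk, Nat.succ_ne_zero, if_false, Nat.add_sub_cancel, Nat.add_lt_add_iff_right,
      Fin.succ_mk]

theorem walk_map {α β : Type*} {j : ℕ} (f : α → β) (x : α) (l : Fin j → α) (y : α) (i : ℕ) :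
    walk (f x) (fun a => f (l a)) (f y) i = f (walk x l y i) := by
  simp only [walk]
  split_ifs <;> rfl

theorem measurable_walk {X : Type*} [MeasurableSpace X] {j : ℕ} {a b : X → Ω} {l : X → Fin j → Ω}
    (ha : Measurable a) (hl : Measurable l) (hb : Measurable b) (i : ℕ) :
    Measurable fun x => walk (a x) (l x) (b x) i := by
  simp only [walk]
  split_ifs
  · exact ha
  · exact (measurable_pi_apply _).comp hl
  · exact hb

/-- The two factors run along the two arcs from `0` to `j + 1`; the reduction modulo the length
matters only at `i = 0`. For `j = 0` both arcs would be the same edge. -/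
theorem prod_edges_D {j : ℕ} (hj : 0 < j) (F : Fin (2 * (j + 1)) × Fin (2 * (j + 1)) → ℝ) :
    ∏ e ∈ (D (j + 1)).edges, F e
      = (∏ i : Fin (j + 1), F (⟨i, by omega⟩, ⟨i + 1, by omega⟩)) *
        ∏ i : Fin (j + 1), F (⟨(2 * (j + 1) - i) % (2 * (j + 1)), Nat.mod_lt _ (by omega)⟩,
          ⟨2 * (j + 1) - (i + 1), by omega⟩) := by
  have hmod : ∀ i, i < j + 1 → (i = 0 ∧ (2 * (j + 1) - i) % (2 * (j + 1)) = 0) ∨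
      (0 < i ∧ (2 * (j + 1) - i) % (2 * (j + 1)) = 2 * (j + 1) - i) := by
    intro i hi
    rcases Nat.eq_zero_or_pos i with rfl | h
    · simp
    · exact .inr ⟨h, Nat.mod_eq_of_lt (by omega)⟩
  rw [prod_edges_eq (ι := Fin (j + 1) ⊕ Fin (j + 1)) (g := Sum.elim
    (fun i => (⟨i, by omega⟩, ⟨i + 1, by omega⟩))
    (fun i => (⟨(2 * (j + 1) - i) % (2 * (j + 1)), Nat.mod_lt _ (by omega)⟩,
          ⟨2 * (j + 1) - (i + 1), by omega⟩)))]
  · rw [Fintype.prod_sum_type]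
    rfl
  · rintro (a | a) (b | b) h <;>
      · simp only [Sum.elim_inl, Sum.elim_inr, Prod.mk.injEq, Fin.mk.injEq] at h
        have ha := hmod a a.isLt
        have hb := hmod b b.isLt
        first
        | (exfalso; omega)
        | rw [show a = b from Fin.ext (by omega)]
  · intro u v
    have hu := u.isLt
    have hv := v.isLt
    constructor
    · rintro (⟨h1, h2⟩ | ⟨h1, h2⟩)
      · refine ⟨.inl ⟨u, h1⟩, ?_⟩
        exact Prod.ext rfl (Fin.ext h2.symm)
      · refine ⟨.inr ⟨2 * (j + 1) - (v + 1), by omega⟩, ?_⟩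
        simp only [Sum.elim_inr, Prod.mk.injEq]
        constructor <;> ext <;> dsimp only
        · rw [h2]; congr 1; omega
        · omega
    · rintro ⟨a | a, h⟩
      · simp only [Sum.elim_inl, Prod.mk.injEq] at h
        obtain ⟨rfl, rfl⟩ := h
        exact .inl ⟨a.isLt, rfl⟩
      · simp only [Sum.elim_inr, Prod.mk.injEq] at h
        obtain ⟨rfl, rfl⟩ := h
        refine .inr ⟨by dsimp only; omega, ?_⟩
        dsimp only
        congr 1; omega

/-- The two arcs are copies of one directed path with `j` inner vertices, glued at both ends. -/
theorem density_D {j : ℕ} (hj : 0 < j) (hB : IsSkewKernel B) :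
    (D (j + 1)).density μ B = ∫ z : Fin 2 → Ω, (∫ l : Fin j → Ω, ∏ i ∈ Finset.range (j + 1),
      B (walk (z 0) l (z 1) i) (walk (z 0) l (z 1) (i + 1)) ∂(Measure.pi fun _ => μ)) ^ 2
        ∂(Measure.pi fun _ => μ) := by
  set f : Fin 2 ⊕ (Fin j ⊕ Fin j) → Fin (2 * (j + 1)) := Sum.elim
    (fun i => if i = 0 then ⟨0, by omega⟩ else ⟨j + 1, by omega⟩)
    (Sum.elim (fun a => ⟨a + 1, by omega⟩) (fun a => ⟨2 * (j + 1) - (a + 1), by omega⟩)) with hf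
  have hinj : Function.Injective f := by
    rintro (a | a | a) (b | b | b) h <;>
      · simp only [hf, Sum.elim_inl, Sum.elim_inr] at h
        (try split_ifs at h) <;> simp only [Fin.mk.injEq] at h <;>
        first
        | (exfalso; omega)
        | rw [show a = b from Fin.ext (by omega)]
  have hwm := fun i => measurable_walk (Ω := Ω) (X := (Fin 2 → Ω) × (Fin j → Ω))
    (a := fun p => p.1 0) (b := fun p => p.1 1) (l := fun p => p.2)
    ((measurable_pi_apply 0).comp measurable_fst) measurable_snd
    ((measurable_pi_apply 1).comp measurable_fst) i
  rw [← integral_glue (μ := μ) hinj (G := fun z l => ∏ i ∈ Finset.range (j + 1),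
      B (walk (z 0) l (z 1) i) (walk (z 0) l (z 1) (i + 1)))
    (measurable_prod_kernel hB.measurable _ (fun i => hwm _) (fun i => hwm _))
    (fun z l => hB.abs_prod_le _ _ _)]
  refine integral_congr_ae (.of_forall fun x => ?_)
  dsimp only
  rw [prod_edges_D hj fun e => B (x e.1) (x e.2), Finset.prod_range, Finset.prod_range]
  simp only [walk_map x]
  have hw1 : ∀ i (hi : i ≤ j + 1), walk (f (.inl 0)) (fun a => f (.inr (.inl a))) (f (.inl 1)) i
      = ⟨i, by omega⟩ := by
    intro i hi
    simp only [walk, hf, Sum.elim_inl, Sum.elim_inr]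
    split_ifs <;> ext <;> simp_all <;> omega
  have hw2 : ∀ i (hi : i ≤ j + 1), walk (f (.inl 0)) (fun a => f (.inr (.inr a))) (f (.inl 1)) i
      = ⟨(2 * (j + 1) - i) % (2 * (j + 1)), Nat.mod_lt _ (by omega)⟩ := by
    intro i hi
    rcases Nat.eq_zero_or_pos i with rfl | h
    · simp [walk, hf]
    · ext
      simp only [walk, hf, Sum.elim_inl, Sum.elim_inr]
      rw [Nat.mod_eq_of_lt (by omega)]
      split_ifs <;> simp_all <;> omega
  congr 1 <;> refine Finset.prod_congr rfl fun i _ => ?_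
  · rw [hw1 _ (by omega), hw1 _ (by omega)]
  · rw [hw2 _ (by omega), hw2 _ (by omega)]
    congr 3
    rw [Nat.mod_eq_of_lt (by omega)]

end Density
end OrientedGraph

/-! ### The integral operator of a skew-symmetric kernel -/

section Operator

variable {Ω : Type*} [MeasurableSpace Ω] (μ : Measure Ω) (B : Ω → Ω → ℝ)

/-- The integral operator with kernel `B`. -/
noncomputable def kernelOp (g : Ω → ℝ) (x : Ω) : ℝ := ∫ y, B x y * g y ∂μ

/-- The kernel of the `(j + 1)`-st power of the integral operator with kernel `B`. -/
noncomputable def kernelPow : ℕ → Ω → Ω → ℝ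
  | 0 => B
  | j + 1 => fun x y => ∫ z, B x z * kernelPow j z y ∂μ

/-- A measurable function with values in `[-1, 1]`. -/
structure IsUnitBounded {X : Type*} [MeasurableSpace X] (g : X → ℝ) : Prop where
  measurable : Measurable g
  abs_le : ∀ x, |g x| ≤ 1

variable {μ B} [IsProbabilityMeasure μ]

namespace IsUnitBounded

variable {X Y : Type*} [MeasurableSpace X] [MeasurableSpace Y] {f g : X → ℝ}

theorem mul (hf : IsUnitBounded f) (hg : IsUnitBounded g) : IsUnitBounded fun x => f x * g x :=
  ⟨hf.measurable.mul hg.measurable, fun x => by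
    rw [abs_mul]; exact mul_le_one₀ (hf.abs_le x) (abs_nonneg _) (hg.abs_le x)⟩

theorem comp (hf : IsUnitBounded f) {φ : Y → X} (hφ : Measurable φ) :
    IsUnitBounded fun y => f (φ y) :=
  ⟨hf.measurable.comp hφ, fun _ => hf.abs_le _⟩

theorem integrable (hf : IsUnitBounded f) {ν : Measure X} [IsFiniteMeasure ν] : Integrable f ν :=
  hf.measurable.integrable_of_abs_le hf.abs_le

theorem integral {F : X → Y → ℝ} (hF : IsUnitBounded (Function.uncurry F)) {ν : Measure Y}
    [IsProbabilityMeasure ν] : IsUnitBounded fun x => ∫ y, F x y ∂ν :=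
  ⟨hF.measurable.integral_right, fun x => abs_integral_le_of_abs_le fun y => hF.abs_le (x, y)⟩

theorem right {F : X → Y → ℝ} (hF : IsUnitBounded (Function.uncurry F)) (x : X) :
    IsUnitBounded (F x) := hF.comp measurable_prodMk_left

theorem sq_integral_le (hf : IsUnitBounded f) {ν : Measure X} [IsProbabilityMeasure ν] :
    (∫ x, f x ∂ν) ^ 2 ≤ ∫ x, f x * f x ∂ν :=
  (sq_integral_le_integral_sq hf.measurable hf.abs_le).trans_eq (by simp_rw [sq])

end IsUnitBounded

theorem IsSkewKernel.isUnitBounded (hB : IsSkewKernel B) : IsUnitBounded (Function.uncurry B) :=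
  ⟨hB.measurable, fun p => hB.abs_le p.1 p.2⟩

theorem IsUnitBounded.kernelOp {g : Ω → ℝ} (hB : IsSkewKernel B) (hg : IsUnitBounded g) :
    IsUnitBounded (kernelOp μ B g) :=
  IsUnitBounded.integral (F := fun x y => B x y * g y)
    (hB.isUnitBounded.mul (hg.comp measurable_snd))

theorem IsUnitBounded.iterate_kernelOp {g : Ω → ℝ} (hB : IsSkewKernel B) (hg : IsUnitBounded g)
    (j : ℕ) : IsUnitBounded ((_root_.kernelOp μ B)^[j] g) := by
  induction j with
  | zero => exact hg
  | succ j ih => rw [Function.iterate_succ_apply']; exact ih.kernelOp hB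

theorem isUnitBounded_kernelPow (hB : IsSkewKernel B) (j : ℕ) :
    IsUnitBounded (Function.uncurry (kernelPow μ B j)) := by
  induction j with
  | zero => exact hB.isUnitBounded
  | succ j ih =>
    exact IsUnitBounded.integral (F := fun (p : Ω × Ω) z => B p.1 z * kernelPow μ B j z p.2)
      ((hB.isUnitBounded.comp (φ := fun q : (Ω × Ω) × Ω => (q.1.1, q.2)) (by fun_prop)).mul
        (ih.comp (φ := fun q : (Ω × Ω) × Ω => (q.2, q.1.2)) (by fun_prop)))

theorem iterate_kernelOp_succ {g : Ω → ℝ} (hB : IsSkewKernel B) (hg : IsUnitBounded g) (j : ℕ)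
    (x : Ω) : (kernelOp μ B)^[j + 1] g x = ∫ y, kernelPow μ B j x y * g y ∂μ := by
  induction j generalizing x with
  | zero => rfl
  | succ j ih =>
    rw [Function.iterate_succ_apply']
    have h1 : kernelOp μ B ((kernelOp μ B)^[j + 1] g) x
        = ∫ z, ∫ y, B x z * (kernelPow μ B j z y * g y) ∂μ ∂μ := by
      simp only [kernelOp, integral_const_mul]
      exact integral_congr_ae (.of_forall fun z => congrArg (B x z * ·) (ih z))
    have h2 : ∀ y, kernelPow μ B (j + 1) x y * g y
        = ∫ z, B x z * (kernelPow μ B j z y * g y) ∂μ := fun y => by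
      rw [kernelPow, ← integral_mul_const]
      exact integral_congr_ae (.of_forall fun z => mul_assoc _ _ _)
    simp only [h2]
    rw [h1]
    refine integral_integral_swap (IsUnitBounded.integrable ?_)
    exact ((hB.isUnitBounded.right x).comp measurable_fst).mul
      ((isUnitBounded_kernelPow hB j).mul (hg.comp measurable_snd))

/-- By Fubini, skew-symmetry of the kernel makes the operator skew-adjoint. -/
theorem integral_mul_kernelOp {f g : Ω → ℝ} (hB : IsSkewKernel B) (hf : IsUnitBounded f)
    (hg : IsUnitBounded g) :
    ∫ x, f x * kernelOp μ B g x ∂μ = -∫ x, kernelOp μ B f x * g x ∂μ := by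
  have h1 : ∫ x, f x * kernelOp μ B g x ∂μ = ∫ x, ∫ y, f x * (B x y * g y) ∂μ ∂μ := by
    simp only [kernelOp, integral_const_mul]
  have h2 : -∫ x, kernelOp μ B f x * g x ∂μ = ∫ y, ∫ x, f x * (B x y * g y) ∂μ ∂μ := by
    rw [← integral_neg]
    refine integral_congr_ae (.of_forall fun y => ?_)
    simp only [kernelOp]
    rw [← integral_mul_const, ← integral_neg]
    refine integral_congr_ae (.of_forall fun x => ?_)
    simp only [hB.swap y x]
    ring
  rw [h1, h2]
  exact integral_integral_swap (IsUnitBounded.integrable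
    ((hf.comp measurable_fst).mul (hB.isUnitBounded.mul (hg.comp measurable_snd))))

/-- The square of the `L²`-norm of the image of `g` under the `j`-th power of the operator. -/
noncomputable def normSqPow (μ : Measure Ω) (B : Ω → Ω → ℝ) (g : Ω → ℝ) (j : ℕ) : ℝ :=
  ∫ x, (kernelOp μ B)^[j] g x * (kernelOp μ B)^[j] g x ∂μ

omit [IsProbabilityMeasure μ] in
theorem normSqPow_nonneg (g : Ω → ℝ) (j : ℕ) : 0 ≤ normSqPow μ B g j :=
  integral_nonneg fun _ => mul_self_nonneg _

/-- Each transfer of the operator to the other factor costs a sign, which the absolute value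
absorbs. -/
theorem abs_integral_iterate_mul {g : Ω → ℝ} (hB : IsSkewKernel B) (hg : IsUnitBounded g)
    (i j : ℕ) : |∫ x, (kernelOp μ B)^[i] g x * (kernelOp μ B)^[j] g x ∂μ|
      = |∫ x, g x * (kernelOp μ B)^[i + j] g x ∂μ| := by
  induction i generalizing j with
  | zero => simp
  | succ i ih =>
    rw [Function.iterate_succ_apply', ← abs_neg,
      ← integral_mul_kernelOp hB (hg.iterate_kernelOp hB i) (hg.iterate_kernelOp hB j),
      ← Function.iterate_succ_apply' (kernelOp μ B), ih, show i + 1 + j = i + (j + 1) by ring]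

/-- With $T$ the operator, $\|T^jg\|^2=|\langle g,T^{2j}g\rangle|$, and $|g|\le 1$ bounds the square
of this by $\|T^{2j}g\|^2$. -/
theorem normSqPow_sq_le {g : Ω → ℝ} (hB : IsSkewKernel B) (hg : IsUnitBounded g) (j : ℕ) :
    normSqPow μ B g j ^ 2 ≤ normSqPow μ B g (2 * j) := by
  rw [← sq_abs, normSqPow, abs_integral_iterate_mul hB hg, sq_abs, ← two_mul]
  have h := hg.iterate_kernelOp (μ := μ) hB (2 * j)
  refine (hg.mul h).sq_integral_le.trans (integral_mono ((hg.mul h).mul (hg.mul h)).integrable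
    (h.mul h).integrable fun x => ?_)
  have h1 : g x * g x ≤ 1 := by
    rw [← abs_mul_abs_self]; exact mul_le_one₀ (hg.abs_le x) (abs_nonneg _) (hg.abs_le x)
  dsimp only
  nlinarith [mul_self_nonneg ((kernelOp μ B)^[2 * j] g x)]

/-- Since $|B|\le 1$, Cauchy–Schwarz makes the operator an $L^2$-contraction; the bound even holds
pointwise. -/
theorem normSqPow_succ_le {g : Ω → ℝ} (hB : IsSkewKernel B) (hg : IsUnitBounded g) (j : ℕ) :
    normSqPow μ B g (j + 1) ≤ normSqPow μ B g j := by
  have h := hg.iterate_kernelOp (μ := μ) hB j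
  have h' := hg.iterate_kernelOp (μ := μ) hB (j + 1)
  have : ∀ x, (kernelOp μ B)^[j + 1] g x * (kernelOp μ B)^[j + 1] g x ≤ normSqPow μ B g j := by
    intro x
    have hBx := hB.isUnitBounded.right x
    rw [Function.iterate_succ_apply', ← sq]
    refine (hBx.mul h).sq_integral_le.trans (integral_mono ((hBx.mul h).mul (hBx.mul h)).integrable
      (h.mul h).integrable fun y => ?_)
    have h1 : B x y * B x y ≤ 1 := by
      rw [← abs_mul_abs_self]; exact mul_le_one₀ (hBx.abs_le y) (abs_nonneg _) (hBx.abs_le y)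
    dsimp only
    nlinarith [mul_self_nonneg ((kernelOp μ B)^[j] g y)]
  refine (integral_mono (h'.mul h').integrable (integrable_const _) this).trans_eq ?_
  simp

theorem normSqPow_one_pow_le {g : Ω → ℝ} (hB : IsSkewKernel B) (hg : IsUnitBounded g) (m : ℕ) :
    normSqPow μ B g 1 ^ 2 ^ m ≤ normSqPow μ B g (2 ^ m) := by
  induction m with
  | zero => simp
  | succ m ih =>
    rw [pow_succ, pow_mul, mul_comm]
    exact (pow_le_pow_left₀ (pow_nonneg (normSqPow_nonneg _ _) _) ih 2).trans
      (normSqPow_sq_le hB hg _)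

/-- The inner vertices are integrated out one at a time. Peeling off the first one changes the
starting point, so the induction generalizes `x`. -/
theorem integral_walk (hB : IsSkewKernel B) (j : ℕ) (x y : Ω) :
    ∫ l : Fin j → Ω, ∏ i ∈ Finset.range (j + 1),
      B (OrientedGraph.walk x l y i) (OrientedGraph.walk x l y (i + 1)) ∂(Measure.pi fun _ => μ)
      = kernelPow μ B j x y := by
  induction j generalizing x with
  | zero =>
    have : ∀ l : Fin 0 → Ω, OrientedGraph.walk x l y 1 = y := fun l => rfl
    simp [OrientedGraph.walk_zero, this, kernelPow]
  | succ j ih =>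
    have e := (measurePreserving_piFinSuccAbove (fun _ : Fin (j + 1) => μ) 0).integral_comp'
      (g := fun p : Ω × (Fin j → Ω) => B x p.1 * ∏ i ∈ Finset.range (j + 1),
        B (OrientedGraph.walk p.1 p.2 y i) (OrientedGraph.walk p.1 p.2 y (i + 1)))
    have hw : ∀ i, Measurable fun p : Ω × (Fin j → Ω) => OrientedGraph.walk p.1 p.2 y i :=
      fun i => OrientedGraph.measurable_walk measurable_fst measurable_snd measurable_const i
    have hi : IsUnitBounded fun p : Ω × (Fin j → Ω) => B x p.1 * ∏ i ∈ Finset.range (j + 1),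
        B (OrientedGraph.walk p.1 p.2 y i) (OrientedGraph.walk p.1 p.2 y (i + 1)) :=
      ((hB.isUnitBounded.right x).comp measurable_fst).mul
        ⟨OrientedGraph.measurable_prod_kernel hB.measurable _ (fun i => hw i) (fun i => hw (i + 1)),
          fun p => hB.abs_prod_le _ _ _⟩
    have e2 := integral_prod _ (hi.integrable (ν := μ.prod (Measure.pi fun _ : Fin j => μ)))
    refine Eq.trans ?_ (e.trans (e2.trans ?_))
    · refine integral_congr_ae (.of_forall fun l => ?_)
      dsimp only
      rw [Finset.prod_range_succ', mul_comm, OrientedGraph.walk_zero]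
      simp only [OrientedGraph.walk_succ]
      rfl
    · simp only [integral_const_mul, ih]
      rfl

namespace OrientedGraph

theorem density_D_eq {j : ℕ} (hj : 0 < j) (hB : IsSkewKernel B) :
    (D (j + 1)).density μ B = ∫ x, ∫ y, kernelPow μ B j x y * kernelPow μ B j x y ∂μ ∂μ := by
  have hK := isUnitBounded_kernelPow (μ := μ) hB j
  rw [density_D hj hB]
  simp only [integral_walk hB]
  have e := (measurePreserving_finTwoArrow μ).integral_comp' (g := fun p : Ω × Ω =>
    kernelPow μ B j p.1 p.2 ^ 2)
  have e2 := integral_prod _ ((hK.mul hK).integrable (ν := μ.prod μ))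
  refine e.trans (Eq.trans ?_ e2)
  exact integral_congr_ae (.of_forall fun p => sq _)

/-- The density of $D_{2k}$ is the squared Hilbert–Schmidt norm of the $k$-th power, which dominates
its value on any $g$ with $|g|\le 1$. -/
theorem normSqPow_le_density_D {k : ℕ} (hk : 2 ≤ k) (hB : IsSkewKernel B) {g : Ω → ℝ}
    (hg : IsUnitBounded g) : normSqPow μ B g k ≤ (D k).density μ B := by
  obtain ⟨j, rfl⟩ : ∃ j, k = j + 1 := ⟨k - 1, by omega⟩
  have hK := isUnitBounded_kernelPow (μ := μ) hB j
  rw [density_D_eq (by omega) hB, normSqPow]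
  have h' := hg.iterate_kernelOp (μ := μ) hB (j + 1)
  refine integral_mono (h'.mul h').integrable (IsUnitBounded.integrable
    (IsUnitBounded.integral (F := fun x y => kernelPow μ B j x y * kernelPow μ B j x y)
      (hK.mul hK))) fun x => ?_
  have hKx := hK.right x
  dsimp only
  rw [iterate_kernelOp_succ hB hg, ← sq]
  refine (hKx.mul hg).sq_integral_le.trans (integral_mono ((hKx.mul hg).mul (hKx.mul hg)).integrable
      (hKx.mul hKx).integrable fun y => ?_)
  have h1 : g y * g y ≤ 1 := by
    rw [← abs_mul_abs_self]; exact mul_le_one₀ (hg.abs_le y) (abs_nonneg _) (hg.abs_le y)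
  dsimp only
  nlinarith [mul_self_nonneg (kernelPow μ B j x y)]

/-- All bilinear averages of a skew-symmetric kernel are controlled by the density of `D_{2k}`. -/
theorem abs_bilinear_pow_le {k : ℕ} (hk : 2 ≤ k) (hB : IsSkewKernel B) {f g : Ω → ℝ}
    (hf : IsUnitBounded f) (hg : IsUnitBounded g) :
    |∫ p, f p.1 * B p.1 p.2 * g p.2 ∂(μ.prod μ)| ^ 2 ^ (k + 1) ≤ (D k).density μ B := by
  have h1 : ∫ p, f p.1 * B p.1 p.2 * g p.2 ∂(μ.prod μ) = ∫ x, f x * kernelOp μ B g x ∂μ := by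
    have := integral_prod _ ((((hf.comp measurable_fst).mul hB.isUnitBounded).mul
      (hg.comp measurable_snd)).integrable (ν := μ.prod μ))
    refine this.trans (integral_congr_ae (.of_forall fun x => ?_))
    simp only [kernelOp, ← integral_const_mul, Function.uncurry]
    exact integral_congr_ae (.of_forall fun y => mul_assoc _ _ _)
  have hT : IsUnitBounded (kernelOp μ B g) := hg.kernelOp hB
  have h2 : |∫ p, f p.1 * B p.1 p.2 * g p.2 ∂(μ.prod μ)| ^ 2 ≤ normSqPow μ B g 1 := by
    rw [h1, sq_abs]
    refine (hf.mul hT).sq_integral_le.trans (integral_mono ((hf.mul hT).mul (hf.mul hT)).integrable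
      (hT.mul hT).integrable fun x => ?_)
    have h1 : f x * f x ≤ 1 := by
      rw [← abs_mul_abs_self]; exact mul_le_one₀ (hf.abs_le x) (abs_nonneg _) (hf.abs_le x)
    rw [Function.iterate_one]
    nlinarith [mul_self_nonneg (kernelOp μ B g x)]
  -- One squaring leads from the bilinear average to $\|Tg\|^2$, and `k` doublings lead to
  -- $\|T^{2^k}g\|^2$; this explains the exponent. As $k\le 2^k$, contraction brings the power back
  -- down to `k`.
  rw [pow_succ', pow_mul]
  refine (pow_le_pow_left₀ (sq_nonneg _) h2 _).trans ((normSqPow_one_pow_le hB hg k).trans ?_)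
  have hanti : Antitone (normSqPow μ B g) := antitone_nat_of_succ_le (normSqPow_succ_le hB hg)
  exact (hanti k.lt_two_pow_self.le).trans (normSqPow_le_density_D hk hB hg)

end OrientedGraph

end Operator

namespace OrientedGraph

/-! ### Linear forests -/

section LinearForest

/-- The subgraph of the directed path `0 → 1 → ⋯ → N - 1` formed by the edges `i → i + 1` with
`i ∈ J`. -/
def linearForest (N : ℕ) (J : Finset ℕ) : OrientedGraph (Fin N) where
  Adj i j := j.val = i.val + 1 ∧ i.val ∈ J
  asymm i j h h' := by omega

variable {Ω : Type*} [MeasurableSpace Ω] {μ : Measure Ω} [IsProbabilityMeasure μ] {B : Ω → Ω → ℝ}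

/-- A component that is a path of odd length makes the density vanish. -/
theorem density_linearForest_eq_zero (hB : IsSkewKernel B) {N : ℕ} {J : Finset ℕ} {a l : ℕ}
    (hl : Odd l) (haN : a + l < N) (hrun : ∀ i < l, a + i ∈ J) (hstart : a = 0 ∨ a - 1 ∉ J)
    (hend : a + l ∉ J) : (linearForest N J).density μ B = 0 := by
  classical
  have hrun' : ∀ i, a ≤ i → i < a + l → i ∈ J := fun i h1 h2 => by
    have := hrun (i - a) (by omega)
    rwa [Nat.add_sub_cancel' h1] at this
  -- The reflection of the segment from `a` to `a + l`, fixing all other vertices.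
  set τ : Fin N → Fin N := fun i =>
    if h : a ≤ i.val ∧ i.val ≤ a + l then ⟨2 * a + l - i, by omega⟩ else i with hτ
  have hτv : ∀ i : Fin N, (a ≤ i.val ∧ i.val ≤ a + l ∧ (τ i).val = 2 * a + l - i) ∨
      ((i.val < a ∨ a + l < i.val) ∧ τ i = i) := fun i => by
    by_cases h : a ≤ i.val ∧ i.val ≤ a + l
    · exact .inl ⟨h.1, h.2, by simp [hτ, h]⟩
    · exact .inr ⟨by omega, by simp only [hτ, dif_neg h]⟩
  have hinv : Function.Involutive τ := fun i => by
    rcases hτv i with ⟨h1, h2, h3⟩ | ⟨h1, h2⟩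
    · rcases hτv (τ i) with ⟨h4, h5, h6⟩ | ⟨h4, h5⟩
      · ext; omega
      · omega
    · rw [h2, h2]
  set R : Finset (Fin N × Fin N) :=
    (linearForest N J).edges.filter fun e => a ≤ e.1.val ∧ e.1.val < a + l with hR
  have hcard : R.card = l := by
    rw [← Finset.card_range l]
    symm
    refine Finset.card_bij (fun i hi => (⟨a + i, by have := Finset.mem_range.1 hi; omega⟩,
      ⟨a + i + 1, by have := Finset.mem_range.1 hi; omega⟩)) ?_ ?_ ?_
    · intro i hi
      have hi' := Finset.mem_range.1 hi
      simp only [hR, Finset.mem_filter, mem_edges, linearForest]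
      exact ⟨⟨trivial, hrun i hi'⟩, by omega, by omega⟩
    · intro i hi j hj h
      simp only [Prod.mk.injEq, Fin.mk.injEq] at h
      omega
    · rintro ⟨u, v⟩ h
      simp only [hR, Finset.mem_filter, mem_edges, linearForest] at h
      refine ⟨u - a, Finset.mem_range.2 (by omega), ?_⟩
      ext <;> dsimp only <;> omega
  -- Reflecting the component has the same effect as reversing its `l` edges. By `hstart` and `hend`
  -- the run is maximal, so no edge links the segment to the rest. For odd `l` the density is then
  -- its own negative.
  have hmap : (linearForest N J).map hinv.toPerm.toEmbedding = (linearForest N J).reverse R := by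
    ext x y
    have h1 : ((linearForest N J).map hinv.toPerm.toEmbedding).Adj x y
        ↔ (linearForest N J).Adj (τ x) (τ y) := by
      constructor
      · rintro ⟨u, v, h, rfl, rfl⟩
        change (linearForest N J).Adj (τ (τ u)) (τ (τ v))
        rwa [hinv u, hinv v]
      · intro h
        exact ⟨τ x, τ y, h, hinv x, hinv y⟩
    rw [h1]
    simp only [reverse, hR, Finset.mem_filter, mem_edges, linearForest]
    have hx := hrun' (τ x).val
    have hy := hrun' y.val
    rcases hτv x with ⟨h4, h5, h6⟩ | ⟨h4, h5⟩ <;> rcases hτv y with ⟨h7, h8, h9⟩ | ⟨h7, h8⟩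
    · constructor
      · rintro ⟨h10, h11⟩
        have := hy h7 (by omega)
        exact .inr ⟨⟨by omega, this⟩, ⟨by omega, this⟩, by omega, by omega⟩
      · rintro (⟨⟨h10, h11⟩, h12⟩ | ⟨⟨h10, h11⟩, h12⟩)
        · exact absurd ⟨⟨h10, h11⟩, h4, by omega⟩ h12
        · exact ⟨by omega, hx (by omega) (by omega)⟩
    · rw [h8]
      constructor
      · rintro ⟨h10, h11⟩
        rw [show (τ x).val = a + l by omega] at h11
        exact absurd h11 hend
      · rintro (⟨⟨h10, h11⟩, h12⟩ | ⟨⟨h10, h11⟩, h12⟩)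
        · rw [show x.val = a + l by omega] at h11
          exact absurd h11 hend
        · omega
    · rw [h5]
      constructor
      · rintro ⟨h10, h11⟩
        rcases hstart with h | h
        · omega
        · rw [show x.val = a - 1 by omega] at h11
          exact absurd h11 h
      · rintro (⟨⟨h10, h11⟩, h12⟩ | ⟨⟨h10, h11⟩, h12⟩)
        · rcases hstart with h | h
          · omega
          · rw [show x.val = a - 1 by omega] at h11
            exact absurd h11 h
        · omega
    · rw [h5, h8]
      constructor
      · rintro ⟨h10, h11⟩
        exact .inl ⟨⟨h10, h11⟩, by omega⟩
      · rintro (⟨⟨h10, h11⟩, h12⟩ | ⟨⟨h10, h11⟩, h12⟩)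
        · exact ⟨h10, h11⟩
        · omega
  have h1 := density_map (μ := μ) (linearForest N J) hinv.toPerm.toEmbedding hB.measurable
  rw [hmap, density_reverse _ (Finset.filter_subset _ _) hB, hcard, hl.neg_one_pow] at h1
  linarith

theorem joined_linearForest {N : ℕ} {J : Finset ℕ} (x y : Fin N) :
    (linearForest N J).Joined x y ↔
      (y.val = x.val + 1 ∧ x.val ∈ J) ∨ (x.val = y.val + 1 ∧ y.val ∈ J) := Iff.rfl

theorem exists_run (J : Finset ℕ) (a : ℕ) : ∃ l, (∀ i < l, a + i ∈ J) ∧ a + l ∉ J := by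
  classical
  have : ∃ l, a + l ∉ J := by
    by_contra! h
    exact (Set.infinite_of_injective_forall_mem (add_right_injective a) h) J.finite_toSet
  exact ⟨Nat.find this, fun i hi => not_not.1 (Nat.find_min this hi), Nat.find_spec this⟩

/-- A linear forest all of whose components have even length is a union of paths. -/
theorem linearForest_eq_pathUnion {N : ℕ} {J : Finset ℕ} (hJ : ∀ i ∈ J, i + 1 < N)
    (hne : J.Nonempty)
    (heven : ∀ a l, (a = 0 ∨ a - 1 ∉ J) → (∀ i < l, a + i ∈ J) → a + l ∉ J → Even l) :
    ∃ (m : ℕ) (n : Fin m → ℕ), 0 < m ∧ (∀ i, 0 < n i) ∧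
      ∃ f, (pathUnion n).IsReorientedImage f (linearForest N J) := by
  classical
  choose len hlen1 hlen2 using exists_run J
  -- The left ends of the maximal runs of `J`; each run is one path component.
  set S := J.filter fun a => a = 0 ∨ a - 1 ∉ J with hS
  have hSmem : ∀ a, a ∈ S ↔ a ∈ J ∧ (a = 0 ∨ a - 1 ∉ J) := fun a => Finset.mem_filter
  have hrun : ∀ a i, a ≤ i → i < a + len a → i ∈ J := fun a i h1 h2 => by
    have := hlen1 a (i - a) (by omega)
    rwa [Nat.add_sub_cancel' h1] at this
  have hpos : ∀ a ∈ S, 0 < len a := fun a ha => by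
    by_contra h
    have := hlen2 a
    rw [show len a = 0 by omega, add_zero] at this
    exact this ((hSmem a).1 ha).1
  have hev : ∀ a ∈ S, 2 * (len a / 2) = len a := fun a ha =>
    Nat.two_mul_div_two_of_even (heven a _ ((hSmem a).1 ha).2 (hlen1 a) (hlen2 a))
  have hlt : ∀ a ∈ S, a + len a < N := fun a ha => by
    have h := hpos a ha
    have := hJ _ (hrun a (a + len a - 1) (by omega) (by omega))
    omega
  have hdisj : ∀ a ∈ S, ∀ b ∈ S, a < b → a + len a < b := fun a ha b hb h => by
    by_contra! h'
    rcases ((hSmem b).1 hb).2 with h1 | h1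
    · omega
    · exact h1 (hrun a _ (by omega) (by omega))
  have hcover : ∀ j ∈ J, ∃ a ∈ S, a ≤ j ∧ j < a + len a := by
    intro j
    induction j with
    | zero =>
      intro hj
      have : 0 ∈ S := (hSmem 0).2 ⟨hj, .inl rfl⟩
      exact ⟨0, this, le_rfl, by have := hpos 0 this; omega⟩
    | succ j ih =>
      intro hj
      by_cases h : j ∈ J
      · obtain ⟨a, ha, h1, h2⟩ := ih h
        refine ⟨a, ha, by omega, ?_⟩
        by_contra h3
        rw [show j + 1 = a + len a by omega] at hj
        exact hlen2 a hj
      · have : j + 1 ∈ S := (hSmem _).2 ⟨hj, .inr h⟩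
        exact ⟨j + 1, this, le_rfl, by have := hpos _ this; omega⟩
  obtain ⟨s, hsS, hsinj, hsurj⟩ : ∃ s : Fin S.card → ℕ, (∀ i, s i ∈ S) ∧
      (∀ i j, s i = s j → i = j) ∧ ∀ a ∈ S, ∃ i, s i = a :=
    ⟨fun i => (S.equivFin.symm i).val, fun i => (S.equivFin.symm i).2,
      fun i j h => S.equivFin.symm.injective (Subtype.ext h),
      fun a ha => ⟨S.equivFin ⟨a, ha⟩, by simp⟩⟩
  obtain ⟨n, hn⟩ : ∃ n : Fin S.card → ℕ, ∀ i, 2 * n i = len (s i) :=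
    ⟨fun i => len (s i) / 2, fun i => hev _ (hsS i)⟩
  obtain ⟨f, hf⟩ : ∃ f : (Σ i, Fin (2 * n i + 1)) ↪ Fin N, ∀ i c, (f ⟨i, c⟩).val = s i + c := by
    have hnlt : ∀ p : Σ i, Fin (2 * n i + 1), s p.1 + p.2 < N := fun p => by
      have := hlt _ (hsS p.1)
      have := hn p.1
      omega
    refine ⟨⟨fun p => ⟨s p.1 + p.2, hnlt p⟩, ?_⟩, fun i c => rfl⟩
    rintro ⟨i, c⟩ ⟨j, d⟩ h
    simp only [Fin.mk.injEq] at h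
    have hi := hn i
    have hj := hn j
    have hc := c.isLt
    have hd := d.isLt
    obtain rfl : i = j := hsinj i j <| by
      rcases lt_trichotomy (s i) (s j) with h1 | h1 | h1
      · have := hdisj _ (hsS i) _ (hsS j) h1; omega
      · exact h1
      · have := hdisj _ (hsS j) _ (hsS i) h1; omega
    obtain rfl : c = d := Fin.ext (by omega)
    rfl
  refine ⟨S.card, n, ?_, ?_, f, ?_⟩
  · obtain ⟨j, hj⟩ := hne
    obtain ⟨a, ha, -⟩ := hcover j hj
    exact Finset.card_pos.2 ⟨a, ha⟩
  · intro i
    have := hpos _ (hsS i)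
    have := hn i
    omega
  · have hforward : ∀ x y : Fin N, y.val = x.val + 1 → x.val ∈ J →
        ∃ i, ∃ c d : Fin (2 * n i + 1), d.val = c.val + 1 ∧ f ⟨i, c⟩ = x ∧ f ⟨i, d⟩ = y := by
      intro x y h1 h2
      obtain ⟨a, ha, h3, h4⟩ := hcover _ h2
      obtain ⟨i, rfl⟩ := hsurj a ha
      have h6 := hn i
      refine ⟨i, ⟨x - s i, by omega⟩, ⟨y - s i, by omega⟩, ?_, ?_, ?_⟩
      · dsimp only; omega
      · ext; rw [hf]; dsimp only; omega
      · ext; rw [hf]; dsimp only; omega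
    intro x y
    rw [joined_linearForest]
    simp only [joined_disjointUnion, joined_Q]
    constructor
    · rintro (⟨h1, h2⟩ | ⟨h1, h2⟩)
      · obtain ⟨i, c, d, h3, h4, h5⟩ := hforward x y h1 h2
        exact ⟨⟨i, c⟩, ⟨i, d⟩, ⟨i, c, d, .inl h3, rfl, rfl⟩, h4, h5⟩
      · obtain ⟨i, c, d, h3, h4, h5⟩ := hforward y x h1 h2
        exact ⟨⟨i, d⟩, ⟨i, c⟩, ⟨i, d, c, .inr h3, rfl, rfl⟩, h5, h4⟩
    · rintro ⟨-, -, ⟨i, c, d, h, rfl, rfl⟩, rfl, rfl⟩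
      have hi := hn i
      have hc := c.isLt
      have hd := d.isLt
      rw [hf, hf]
      rcases h with h | h
      · exact .inl ⟨by omega, hrun _ _ (Nat.le_add_right _ _) (by omega)⟩
      · exact .inr ⟨by omega, hrun _ _ (Nat.le_add_right _ _) (by omega)⟩

end LinearForest

end OrientedGraph

namespace OrientedGraph

/-! ### Orientations of cycles -/

section Cycle

variable {V W X : Type*}

theorem toSimpleGraphInclusive_adj (C : OrientedGraph V) (u v : V) :
    C.toDigraph.toSimpleGraphInclusive.Adj u v ↔ C.Joined u v := by
  rw [Digraph.toSimpleGraphInclusive, SimpleGraph.fromRel_adj]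
  exact ⟨fun h => h.2, fun h => ⟨h.ne, h⟩⟩

theorem fin_sub_val_eq_one {n : ℕ} (hn : 0 < n) (x y : Fin (n + 1)) :
    (x - y).val = 1 ↔ x.val = y.val + 1 ∨ (x.val = 0 ∧ y.val = n) := by
  have hx := x.isLt
  have hy := y.isLt
  rw [Fin.sub_def]
  dsimp only
  rcases Nat.lt_or_ge x.val y.val with h | h
  · rw [Nat.mod_eq_of_lt (by omega)]
    omega
  · rw [show n + 1 - y.val + x.val = (x.val - y.val) + (n + 1) by omega, Nat.add_mod_right,
      Nat.mod_eq_of_lt (by omega)]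
    omega

/-- Adjacency of positions on the cycle `0, 1, …, n`. -/
def CyclicAdj (n x y : ℕ) : Prop :=
  y = x + 1 ∨ x = y + 1 ∨ (x = 0 ∧ y = n) ∨ (x = n ∧ y = 0)

/-- The vertices of a cycle can be enumerated starting and ending with two given neighbours. -/
theorem IsCycleOrientation.exists_enum {C : OrientedGraph V} {n : ℕ} (hn : 0 < n)
    (hC : C.IsCycleOrientation (n + 1)) {u v : V} (huv : C.Joined u v) :
    ∃ p : Fin (n + 1) ≃ V, p 0 = u ∧ p (Fin.last n) = v ∧
      ∀ x y, C.Joined (p x) (p y) ↔ CyclicAdj n x y := by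
  obtain ⟨φ⟩ := hC
  have hφ : ∀ x y, C.Joined (φ.symm x) (φ.symm y) ↔ (x - y).val = 1 ∨ (y - x).val = 1 := by
    intro x y
    rw [← toSimpleGraphInclusive_adj, φ.symm.map_adj_iff, SimpleGraph.cycleGraph_adj']
  have hval : ∀ x : Fin (n + 1), x.val = 1 → x = 1 := fun x hx => by
    ext
    rw [hx, Fin.val_one', Nat.mod_eq_of_lt (by omega)]
  have hlast : (Fin.last n : Fin (n + 1)) = -1 := by
    rw [eq_neg_iff_add_eq_zero, Fin.last_add_one]
  have h1 := (hφ (φ u) (φ v)).1 (by simpa using huv)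
  -- The enumeration starts at `u` and moves away from `v`: a translation if `v` precedes `u` in the
  -- cyclic order, a reflection if it follows.
  rcases h1 with h1 | h1
  · refine ⟨(Equiv.addLeft (φ u)).trans φ.symm.toEquiv, ?_, ?_, fun x y => ?_⟩
    · simp
    · have : φ u + -1 = φ v := by rw [← hval _ h1]; abel
      simp [hlast, this]
    · refine (hφ (φ u + x) (φ u + y)).trans ?_
      rw [add_sub_add_left_eq_sub, add_sub_add_left_eq_sub, fin_sub_val_eq_one hn,
        fin_sub_val_eq_one hn, CyclicAdj]
      omega
  · refine ⟨(Equiv.subLeft (φ u)).trans φ.symm.toEquiv, ?_, ?_, fun x y => ?_⟩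
    · simp
    · have : φ u - -1 = φ v := by rw [← hval _ h1]; abel
      simp [hlast, this]
    · refine (hφ (φ u - x) (φ u - y)).trans ?_
      rw [sub_sub_sub_cancel_left, sub_sub_sub_cancel_left, fin_sub_val_eq_one hn,
        fin_sub_val_eq_one hn, CyclicAdj]
      omega

theorem IsCycleOrientation.exists_joined {C : OrientedGraph V} {n : ℕ} (hn : 0 < n)
    (hC : C.IsCycleOrientation (n + 1)) (u : V) : ∃ v, C.Joined u v := by
  obtain ⟨φ⟩ := hC
  refine ⟨φ.symm (φ u + 1), ?_⟩
  rw [← toSimpleGraphInclusive_adj, ← φ.map_adj_iff, SimpleGraph.cycleGraph_adj',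
    RelIso.apply_symm_apply, add_sub_cancel_left]
  right
  rw [Fin.val_one', Nat.mod_eq_of_lt (by omega)]

/-- Every vertex of a cycle has two distinct neighbours. -/
theorem IsCycleOrientation.exists_joined_ne {C : OrientedGraph V} {n : ℕ} (hn : 1 < n)
    (hC : C.IsCycleOrientation (n + 1)) (u : V) :
    ∃ v w, v ≠ w ∧ C.Joined u v ∧ C.Joined u w := by
  obtain ⟨v, huv⟩ := hC.exists_joined (by omega) u
  obtain ⟨p, rfl, rfl, hp⟩ := hC.exists_enum (by omega) huv
  refine ⟨_, p ⟨1, by omega⟩, fun h => ?_, huv, (hp _ _).2 (.inl (by simp))⟩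
  have := congrArg Fin.val (p.injective h)
  simp at this
  omega

theorem joined_spanning (C : OrientedGraph V) (F : Finset (V × V)) (u v : V) :
    (C.spanning F).Joined u v → C.Joined u v := Or.imp And.left And.left

/-- A proper spanning subgraph of an orientation of a cycle is a linear forest. -/
theorem IsCycleOrientation.spanning_isLinearForest [Fintype V] {C : OrientedGraph V} {n : ℕ}
    (hn : 1 < n) (hC : C.IsCycleOrientation (n + 1)) {F : Finset (V × V)} (hF : F ⊂ C.edges) :
    ∃ (J : Finset ℕ) (p : Fin (n + 1) ≃ V), (∀ i ∈ J, i + 1 < n + 1) ∧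
      (linearForest (n + 1) J).IsReorientedImage p.toEmbedding (C.spanning F) := by
  classical
  -- A missing edge cuts the cycle open: listing the vertices from `u` round to `v` leaves only the
  -- wrap-around pair, which is not joined.
  obtain ⟨⟨u, v⟩, he, heF⟩ := Finset.exists_of_ssubset hF
  have huv : C.Adj u v := mem_edges.1 he
  obtain ⟨p, rfl, rfl, hp⟩ := hC.exists_enum (by omega) (.inl huv)
  have hno : ¬ (C.spanning F).Joined (p 0) (p (Fin.last n)) := by
    rintro (h | h)
    · exact heF h.2
    · exact C.asymm _ _ huv h.1
  refine ⟨(Finset.range n).filter fun i => ∃ h : i < n,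
    (C.spanning F).Joined (p ⟨i, by omega⟩) (p ⟨i + 1, by omega⟩), p, ?_, ?_⟩
  · intro i hi
    have := Finset.mem_range.1 (Finset.mem_filter.1 hi).1
    omega
  · have key : ∀ x y : Fin (n + 1), (C.spanning F).Joined (p x) (p y) ↔
        (linearForest (n + 1) ((Finset.range n).filter fun i => ∃ h : i < n,
          (C.spanning F).Joined (p ⟨i, by omega⟩) (p ⟨i + 1, by omega⟩))).Joined x y := by
      intro x y
      rw [joined_linearForest]
      simp only [Finset.mem_filter, Finset.mem_range]
      constructor
      · intro h
        rcases (hp x y).1 (joined_spanning _ _ _ _ h) with h1 | h1 | ⟨h1, h2⟩ | ⟨h1, h2⟩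
        · have h2 : x.val < n := by omega
          refine .inl ⟨h1, h2, h2, ?_⟩
          rwa [show (⟨x + 1, by omega⟩ : Fin (n + 1)) = y from Fin.ext h1.symm]
        · have h2 : y.val < n := by omega
          refine .inr ⟨h1, h2, h2, ?_⟩
          rw [show (⟨y + 1, by omega⟩ : Fin (n + 1)) = x from Fin.ext h1.symm]
          exact h.symm
        · rw [show x = 0 from Fin.ext h1, show y = Fin.last n from Fin.ext h2] at h
          exact absurd h hno
        · rw [show y = 0 from Fin.ext h2, show x = Fin.last n from Fin.ext h1] at h
          exact absurd h.symm hno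
      · rintro (⟨h1, -, h2, h3⟩ | ⟨h1, -, h2, h3⟩)
        · rwa [show (⟨x + 1, by omega⟩ : Fin (n + 1)) = y from Fin.ext h1.symm] at h3
        · rw [show (⟨y + 1, by omega⟩ : Fin (n + 1)) = x from Fin.ext h1.symm] at h3
          exact h3.symm
    intro a b
    obtain ⟨x, rfl⟩ := p.surjective a
    obtain ⟨y, rfl⟩ := p.surjective b
    rw [key]
    constructor
    · exact fun h => ⟨x, y, h, rfl, rfl⟩
    · rintro ⟨x', y', h, h1, h2⟩
      rwa [← p.injective h1, ← p.injective h2]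

theorem IsReorientedImage.trans {G : OrientedGraph V} {H : OrientedGraph W} {K : OrientedGraph X}
    {f : V ↪ W} {g : W ↪ X} (h : G.IsReorientedImage f H) (h' : H.IsReorientedImage g K) :
    G.IsReorientedImage (f.trans g) K := by
  intro x y
  rw [h']
  constructor
  · rintro ⟨u, v, huv, rfl, rfl⟩
    obtain ⟨a, b, hab, rfl, rfl⟩ := (h u v).1 huv
    exact ⟨a, b, hab, rfl, rfl⟩
  · rintro ⟨a, b, hab, rfl, rfl⟩
    exact ⟨f a, f b, (h.joined a b).2 hab, rfl, rfl⟩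

/-- The spanning subgraph with edge set `F` is, up to directions and isolated vertices, the
disjoint union of the paths `Q_{2n_i}`. -/
def IsPathUnion [Fintype V] (C : OrientedGraph V) {m : ℕ} (n : Fin m → ℕ)
    (F : Finset (V × V)) : Prop :=
  F ⊆ C.edges ∧ ∃ f, (pathUnion n).IsReorientedImage f (C.spanning F)

section Density

variable {Ω : Type*} [MeasurableSpace Ω] {μ : Measure Ω} [IsProbabilityMeasure μ] {B : Ω → Ω → ℝ}

/-- A proper spanning subgraph of a cycle with an edge has zero density or is a union of paths of
even length. -/
theorem IsCycleOrientation.density_eq_zero_or [Fintype V] {C : OrientedGraph V} {n : ℕ}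
    (hn : 1 < n) (hC : C.IsCycleOrientation (n + 1)) (hB : IsSkewKernel B) {F : Finset (V × V)}
    (hF : F ⊂ C.edges) (hne : F.Nonempty) :
    (C.spanning F).density μ B = 0 ∨
      ∃ (m : ℕ) (l : Fin m → ℕ), 0 < m ∧ (∀ i, 0 < l i) ∧ C.IsPathUnion l F := by
  obtain ⟨J, p, hJ, hp⟩ := hC.spanning_isLinearForest hn hF
  by_cases heven : ∀ a l, (a = 0 ∨ a - 1 ∉ J) → (∀ i < l, a + i ∈ J) → a + l ∉ J → Even l
  · have hJne : J.Nonempty := by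
      obtain ⟨e, he⟩ := hne
      have h1 : (C.spanning F).Joined e.1 e.2 := .inl ⟨mem_edges.1 (hF.1 he), he⟩
      obtain ⟨x, y, h | h, -⟩ := (hp _ _).1 h1
      · exact ⟨_, h.2⟩
      · exact ⟨_, h.2⟩
    obtain ⟨m, l, hm, hl, f, hf⟩ := linearForest_eq_pathUnion hJ hJne heven
    exact .inr ⟨m, l, hm, hl, hF.1, _, hf.trans hp⟩
  · left
    push Not at heven
    obtain ⟨a, l, h1, h2, h3, h4⟩ := heven
    obtain ⟨R, hR, hCR⟩ := hp.exists_reverse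
    rw [hCR, density_map_reverse _ _ hR hB]
    have hl : Odd l := by simpa using h4
    have hl0 := hl.pos
    have h5 := hJ _ (h2 (l - 1) (by omega))
    rw [density_linearForest_eq_zero hB hl (by omega) h2 h1 h3, mul_zero]

theorem joined_D {j : ℕ} (x y : Fin (2 * (j + 1))) :
    (D (j + 1)).Joined x y ↔ CyclicAdj (2 * j + 1) x y := by
  have hx := x.isLt
  have hy := y.isLt
  have h1 : ∀ z : ℕ, z < 2 * (j + 1) →
      ((z + 1) % (2 * (j + 1)) = z + 1 ∧ z < 2 * j + 1) ∨
      ((z + 1) % (2 * (j + 1)) = 0 ∧ z = 2 * j + 1) := fun z hz => by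
    rcases Nat.lt_or_ge (z + 1) (2 * (j + 1)) with h | h
    · exact .inl ⟨Nat.mod_eq_of_lt h, by omega⟩
    · have : z + 1 = 2 * (j + 1) := by omega
      exact .inr ⟨by rw [this, Nat.mod_self], by omega⟩
  simp only [Joined, D, CyclicAdj]
  rcases h1 x hx with ⟨h2, h3⟩ | ⟨h2, h3⟩ <;> rcases h1 y hy with ⟨h4, h5⟩ | ⟨h4, h5⟩ <;>
    rw [h2, h4] <;> omega

/-- The density of an orientation of an even cycle in a skew-symmetric kernel. -/
theorem IsCycleOrientation.density_eq_gamma_mul [Fintype V] {C : OrientedGraph V} {k : ℕ}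
    (hk : 2 ≤ k) (hC : C.IsCycleOrientation (2 * k)) (hB : IsSkewKernel B) :
    C.density μ B = C.gamma k * (D k).density μ B := by
  rw [gamma]
  split_ifs with h
  · obtain ⟨R, hR, heven, f, hf⟩ := h
    rw [hf, density_map_reverse _ _ hR hB, heven.neg_one_pow]
    simp
  · obtain ⟨j, rfl⟩ : ∃ j, k = j + 1 := ⟨k - 1, by omega⟩
    obtain ⟨φ⟩ := id hC
    obtain ⟨v, huv⟩ := hC.exists_joined (n := 2 * j + 1) (by omega) (φ.symm ⟨0, by omega⟩)
    obtain ⟨p, -, -, hp⟩ := hC.exists_enum (n := 2 * j + 1) (by omega) huv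
    have himg : (D (j + 1)).IsReorientedImage p.toEmbedding C := by
      intro a b
      obtain ⟨x, rfl⟩ := p.surjective a
      obtain ⟨y, rfl⟩ := p.surjective b
      rw [hp, ← joined_D]
      constructor
      · exact fun h => ⟨x, y, h, rfl, rfl⟩
      · rintro ⟨x', y', h, h1, h2⟩
        rwa [← p.injective h1, ← p.injective h2]
    obtain ⟨R, hR, hCR⟩ := himg.exists_reverse
    -- An even reversal set would put `C` in the other case of the definition of `gamma`.
    have hodd : Odd R.card := by
      rw [← Nat.not_even_iff_odd]
      exact fun heven => h ⟨R, hR, heven, p, hCR⟩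
    conv_lhs => rw [hCR]
    rw [density_map_reverse _ _ hR hB, hodd.neg_one_pow]
    simp

end Density

end Cycle

end OrientedGraph

namespace OrientedGraph

/-! ### The coefficients `α_C` -/

section Alpha

variable {V W X : Type*}

/-- Absence of isolated vertices lets the edges of an image determine the range of the embedding. -/
theorem exists_joined_pathUnion {m : ℕ} {n : Fin m → ℕ} (hn : ∀ i, 0 < n i)
    (p : Σ i, Fin (2 * n i + 1)) : ∃ q, (pathUnion n).Joined p q := by
  obtain ⟨i, c⟩ := p
  have := hn i
  have hc := c.isLt
  rcases Nat.eq_zero_or_pos c.val with h | h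
  · exact ⟨⟨i, ⟨1, by omega⟩⟩, (joined_disjointUnion _ _ _).2
      ⟨i, c, _, (joined_Q _ _ _).2 (.inl (by simp [h])), rfl, rfl⟩⟩
  · exact ⟨⟨i, ⟨c - 1, by omega⟩⟩, (joined_disjointUnion _ _ _).2
      ⟨i, c, _, (joined_Q _ _ _).2 (.inr (by dsimp only; omega)), rfl, rfl⟩⟩

/-- If two graphs without isolated vertices have a common reoriented image, then they have the same
reoriented images. -/
theorem IsReorientedImage.of_common {G : OrientedGraph V} {G' : OrientedGraph W}
    {H K : OrientedGraph X} (hG : ∀ p, ∃ q, G.Joined p q) (hG' : ∀ p, ∃ q, G'.Joined p q)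
    {f : V ↪ X} {f' : W ↪ X} {g : W ↪ X} (hf : G.IsReorientedImage f H)
    (hf' : G'.IsReorientedImage f' H) (hg : G'.IsReorientedImage g K) :
    ∃ h : V ↪ X, G.IsReorientedImage h K := by
  have h1 : ∀ p : V, ∃ p' : W, f' p' = f p := fun p => by
    obtain ⟨q, hq⟩ := hG p
    obtain ⟨a, b, -, ha, -⟩ := (hf' _ _).1 ((hf.joined p q).2 hq)
    exact ⟨a, ha⟩
  have h2 : ∀ p' : W, ∃ p : V, f p = f' p' := fun p => by
    obtain ⟨q, hq⟩ := hG' p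
    obtain ⟨a, b, -, ha, -⟩ := (hf _ _).1 ((hf'.joined p q).2 hq)
    exact ⟨a, ha⟩
  choose e he using h1
  have hinj : Function.Injective e := fun p q h => f.injective (by rw [← he p, ← he q, h])
  have hsurj : Function.Surjective e := fun p' => by
    obtain ⟨p, hp⟩ := h2 p'
    exact ⟨p, f'.injective (by rw [he, hp])⟩
  have hadj : ∀ p q, G'.Joined (e p) (e q) ↔ G.Joined p q := fun p q => by
    rw [← hf'.joined, he, he, hf.joined]
  refine ⟨(⟨e, hinj⟩ : V ↪ W).trans g, fun x y => ?_⟩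
  rw [hg]
  constructor
  · rintro ⟨u, v, huv, rfl, rfl⟩
    obtain ⟨p, rfl⟩ := hsurj u
    obtain ⟨q, rfl⟩ := hsurj v
    exact ⟨p, q, (hadj p q).1 huv, rfl, rfl⟩
  · rintro ⟨p, q, hpq, rfl, rfl⟩
    exact ⟨e p, e q, (hadj p q).2 hpq, rfl, rfl⟩

variable [Fintype V]

/-- Two lists realized by a common `F` describe the same type, so the classes of edge sets are equal
or disjoint. -/
theorem IsPathUnion.of_common {C : OrientedGraph V} {m m' : ℕ} {n : Fin m → ℕ} {n' : Fin m' → ℕ}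
    (hn : ∀ i, 0 < n i) (hn' : ∀ i, 0 < n' i) {F F' : Finset (V × V)} (h : C.IsPathUnion n F)
    (h' : C.IsPathUnion n' F) (h'' : C.IsPathUnion n' F') : C.IsPathUnion n F' := by
  obtain ⟨-, f, hf⟩ := h
  obtain ⟨-, f', hf'⟩ := h'
  obtain ⟨hF', g, hg⟩ := h''
  exact ⟨hF', hf.of_common (exists_joined_pathUnion hn) (exists_joined_pathUnion hn') hf' hg⟩

theorem IsPathUnion.nonempty {C : OrientedGraph V} {m : ℕ} {n : Fin m → ℕ} (hm : 0 < m)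
    (hn : ∀ i, 0 < n i) {F : Finset (V × V)} (h : C.IsPathUnion n F) : F.Nonempty := by
  obtain ⟨-, f, hf⟩ := h
  obtain ⟨q, hq⟩ := exists_joined_pathUnion hn ⟨⟨0, hm⟩, 0⟩
  rcases (hf.joined _ _).2 hq with h | h
  · exact ⟨_, h.2⟩
  · exact ⟨_, h.2⟩

/-- An end vertex of a path has at most one neighbour, whereas every vertex of the cycle has two. -/
theorem IsPathUnion.ssubset {C : OrientedGraph V} {N : ℕ} (hN : 1 < N)
    (hC : C.IsCycleOrientation (N + 1)) {m : ℕ} {n : Fin m → ℕ} (hm : 0 < m)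
    {F : Finset (V × V)} (h : C.IsPathUnion n F) : F ⊂ C.edges := by
  obtain ⟨hF, f, hf⟩ := h
  refine hF.ssubset_of_ne ?_
  rintro rfl
  rw [spanning_edges] at hf
  obtain ⟨v, w, hvw, hv, hw⟩ := hC.exists_joined_ne hN (f ⟨⟨0, hm⟩, 0⟩)
  have key : ∀ v, C.Joined (f ⟨⟨0, hm⟩, 0⟩) v → ∃ c : Fin (2 * n ⟨0, hm⟩ + 1), c.val = 1 ∧
      v = f ⟨⟨0, hm⟩, c⟩ := by
    intro v hv
    obtain ⟨a, b, hab, ha, rfl⟩ := (hf _ _).1 hv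
    obtain ⟨i, c, d, hcd, rfl, rfl⟩ := (joined_disjointUnion _ _ _).1 hab
    obtain ⟨rfl, h1⟩ := Sigma.mk.inj_iff.1 (f.injective ha)
    rw [heq_eq_eq] at h1
    subst h1
    rw [joined_Q] at hcd
    simp only [Fin.val_zero] at hcd
    exact ⟨d, by omega, rfl⟩
  obtain ⟨c, hc, rfl⟩ := key v hv
  obtain ⟨d, hd, rfl⟩ := key w hw
  exact hvw (by rw [show c = d from Fin.ext (hc.trans hd.symm)])

section Density

variable {Ω : Type*} [MeasurableSpace Ω] {μ : Measure Ω} [IsProbabilityMeasure μ] {B : Ω → Ω → ℝ}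

open Classical in
/-- The subgraphs of a fixed type contribute `α_C` times the density of that type. -/
theorem sum_density_isPathUnion (C : OrientedGraph V) (hB : IsSkewKernel B) {m : ℕ}
    (n : Fin m → ℕ) :
    ∑ F ∈ C.edges.powerset.filter (C.IsPathUnion n), (C.spanning F).density μ B
      = C.alpha n * (pathUnion n).density μ B := by
  obtain ⟨P, hP⟩ : ∃ P : (ℕ → Prop) → Finset (V × V) → Prop, ∀ parity F, P parity F ↔
      ∃ R ⊆ (pathUnion n).edges, parity R.card ∧ ∃ f : (Σ i, Fin (2 * n i + 1)) ↪ V,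
        C.spanning F = ((pathUnion n).reverse R).map f := ⟨_, fun _ _ => Iff.rfl⟩
  have hcount : ∀ parity, C.pathCount parity n = (C.edges.powerset.filter (P parity)).card := by
    intro parity
    rw [pathCount, ← Set.ncard_coe_finset]
    congr 1
    ext F
    simp only [Finset.coe_filter, Finset.mem_powerset, hP]
  have hsub : ∀ parity F, F ∈ C.edges.powerset.filter (P parity) →
      F ∈ C.edges.powerset.filter (C.IsPathUnion n) := by
    intro parity F hF
    obtain ⟨h1, h2⟩ := Finset.mem_filter.1 hF
    obtain ⟨R, -, -, f, hf⟩ := (hP _ _).1 h2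
    refine Finset.mem_filter.2 ⟨h1, Finset.mem_powerset.1 h1, f, ?_⟩
    rw [hf]
    exact isReorientedImage_map_reverse _ _ _
  have hterm : ∀ F ∈ C.edges.powerset.filter (C.IsPathUnion n), (C.spanning F).density μ B
      = (if P Even F then (pathUnion n).density μ B else 0)
        - (if P Odd F then (pathUnion n).density μ B else 0) := by
    intro F hF
    obtain ⟨-, -, f, hf⟩ := Finset.mem_filter.1 hF
    have heven : P Even F → (C.spanning F).density μ B = (pathUnion n).density μ B := by
      rw [hP]
      rintro ⟨R, hR, hpar, f, hf⟩
      rw [hf, density_map_reverse _ _ hR hB, hpar.neg_one_pow, one_mul]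
    have hodd : P Odd F → (C.spanning F).density μ B = -(pathUnion n).density μ B := by
      rw [hP]
      rintro ⟨R, hR, hpar, f, hf⟩
      rw [hf, density_map_reverse _ _ hR hB, hpar.neg_one_pow, neg_one_mul]
    obtain ⟨R, hR, hCR⟩ := hf.exists_reverse
    have hor : P Even F ∨ P Odd F := (Nat.even_or_odd R.card).imp
      (fun h => (hP _ _).2 ⟨R, hR, h, f, hCR⟩) (fun h => (hP _ _).2 ⟨R, hR, h, f, hCR⟩)
    -- If both parities occurred, `F` would be counted in both terms, and its density, being its own
    -- negative, would be zero; the formula covers this case as well.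
    by_cases h1 : P Even F <;> by_cases h2 : P Odd F
    · rw [if_pos h1, if_pos h2]
      linarith [heven h1, hodd h2]
    · rw [if_pos h1, if_neg h2, heven h1, sub_zero]
    · rw [if_neg h1, if_pos h2, hodd h2, zero_sub]
    · exact (hor.elim h1 h2).elim
  have hsum : ∀ parity, ∑ F ∈ C.edges.powerset.filter (C.IsPathUnion n),
      (if P parity F then (pathUnion n).density μ B else 0)
        = C.pathCount parity n * (pathUnion n).density μ B := by
    intro parity
    rw [← Finset.sum_filter, Finset.sum_const, nsmul_eq_mul, hcount]
    congr 3
    ext F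
    rw [Finset.mem_filter]
    constructor
    · exact fun h => Finset.mem_filter.2 ⟨(Finset.mem_filter.1 h.1).1, h.2⟩
    · exact fun h => ⟨hsub _ _ h, (Finset.mem_filter.1 h).2⟩
  rw [Finset.sum_congr rfl hterm, Finset.sum_sub_distrib, hsum, hsum, alpha]
  push_cast
  ring

open Classical in
/-- The sign condition on the coefficients `α_C` determines the sign of the contribution of all
unions of paths. -/
theorem sum_density_pathUnions_nonneg (C : OrientedGraph V) (hB : IsSkewKernel B) {s : ℤ}
    (hs : ∀ (m : ℕ) (n : Fin m → ℕ), 0 < m → (∀ i, 0 < n i) → 0 ≤ s * C.alpha n) :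
    0 ≤ s * ∑ F ∈ C.edges.powerset.filter (fun F => ∃ (m : ℕ) (n : Fin m → ℕ), 0 < m ∧
      (∀ i, 0 < n i) ∧ C.IsPathUnion n F), (C.spanning F).density μ B := by
  set T := C.edges.powerset.filter (fun F => ∃ (m : ℕ) (n : Fin m → ℕ), 0 < m ∧
      (∀ i, 0 < n i) ∧ C.IsPathUnion n F) with hT
  have hTmem : ∀ F, F ∈ T → ∃ (m : ℕ) (n : Fin m → ℕ), 0 < m ∧
      (∀ i, 0 < n i) ∧ C.IsPathUnion n F := fun F hF => (Finset.mem_filter.1 hF).2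
  -- Permuted lists describe the same type, and lists of different lengths have different Lean
  -- types. The class itself therefore serves as the label by which the sum is grouped.
  have hkey : ∀ F, ∃ K : Finset (Finset (V × V)), F ∈ T → ∃ (m : ℕ) (n : Fin m → ℕ), 0 < m ∧
      (∀ i, 0 < n i) ∧ C.IsPathUnion n F ∧ K = C.edges.powerset.filter (C.IsPathUnion n) := by
    intro F
    by_cases hF : F ∈ T
    · obtain ⟨m, n, hm, hn, h⟩ := hTmem F hF
      exact ⟨_, fun _ => ⟨m, n, hm, hn, h, rfl⟩⟩
    · exact ⟨∅, fun h => absurd h hF⟩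
  choose key hkey using hkey
  rw [← Finset.sum_fiberwise_of_maps_to (s := T) (t := T.image key) (g := key)
    (fun F hF => Finset.mem_image_of_mem _ hF), Finset.mul_sum]
  refine Finset.sum_nonneg fun K hK => ?_
  obtain ⟨F₀, hF₀, rfl⟩ := Finset.mem_image.1 hK
  obtain ⟨m, n, hm, hn, h, hK⟩ := hkey F₀ hF₀
  have hfib : T.filter (fun F => key F = key F₀) = C.edges.powerset.filter (C.IsPathUnion n) := by
    ext F
    constructor
    · intro hF
      obtain ⟨hF, hFK⟩ := Finset.mem_filter.1 hF
      obtain ⟨m', n', hm', hn', h', hK'⟩ := hkey F hF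
      rw [← hK, ← hFK, hK']
      exact Finset.mem_filter.2 ⟨(Finset.mem_filter.1 hF).1, h'⟩
    · intro hF
      obtain ⟨hFC, hFn⟩ := Finset.mem_filter.1 hF
      have hFT : F ∈ T := Finset.mem_filter.2 ⟨hFC, m, n, hm, hn, hFn⟩
      refine Finset.mem_filter.2 ⟨hFT, ?_⟩
      obtain ⟨m', n', hm', hn', h', hK'⟩ := hkey F hFT
      rw [hK, hK']
      ext F'
      simp only [Finset.mem_filter]
      exact and_congr_right fun _ => ⟨fun h'' => .of_common hn hn' hFn h' h'',
        fun h'' => .of_common hn' hn h' hFn h''⟩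
  rw [hfib, sum_density_isPathUnion C hB n, ← mul_assoc]
  exact mul_nonneg (by exact_mod_cast hs m n hm hn) (density_pathUnion_nonneg n hB)

/-- The main inequality: the deviation of the density of `C` controls the density of `D_{2k}`. -/
theorem IsCycleOrientation.density_D_le {C : OrientedGraph V} {k : ℕ} (hk : 2 ≤ k)
    (hC : C.IsCycleOrientation (2 * k)) (hB : IsSkewKernel B)
    (hs : ∀ (m : ℕ) (n : Fin m → ℕ), 0 < m → (∀ i, 0 < n i) → 0 ≤ C.gamma k * C.alpha n) :
    (1 / 2) ^ C.edges.card * (D k).density μ B ≤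
      |C.density μ (fun x y => (1 + B x y) / 2) - (1 / 2) ^ C.edges.card| := by
  classical
  obtain ⟨N, hN, hNk⟩ : ∃ N, 1 < N ∧ 2 * k = N + 1 := ⟨2 * k - 1, by omega, by omega⟩
  have hC' : C.IsCycleOrientation (N + 1) := hNk ▸ hC
  set T := C.edges.powerset.filter (fun F => ∃ (m : ℕ) (n : Fin m → ℕ), 0 < m ∧
      (∀ i, 0 < n i) ∧ C.IsPathUnion n F) with hT
  have hTmem : ∀ F, F ∈ T → F.Nonempty ∧ F ⊂ C.edges := fun F hF => by
    obtain ⟨-, m, n, hm, hn, h⟩ := Finset.mem_filter.1 hF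
    exact ⟨h.nonempty hm hn, h.ssubset hN hC' hm⟩
  have hne : C.edges.Nonempty := by
    obtain ⟨φ⟩ := id hC
    obtain ⟨v, h | h⟩ := hC'.exists_joined (by omega) (φ.symm ⟨0, by omega⟩)
    · exact ⟨(_, _), mem_edges.2 h⟩
    · exact ⟨(_, _), mem_edges.2 h⟩
  -- The terms 1 and `C.density μ B` come from the empty set and the full edge set; any other `F`
  -- outside `T` has an odd component and contributes 0.
  have h1 : ∑ F ∈ C.edges.powerset, (C.spanning F).density μ B
      = 1 + (C.density μ B + ∑ F ∈ T, (C.spanning F).density μ B) := by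
    rw [← Finset.add_sum_erase _ _ (Finset.empty_mem_powerset _), density_spanning_empty,
      ← Finset.add_sum_erase _ _ (Finset.mem_erase.2 ⟨hne.ne_empty, Finset.mem_powerset_self _⟩),
      spanning_edges]
    congr 2
    symm
    refine Finset.sum_subset (fun F hF => ?_) fun F hF hFT => ?_
    · obtain ⟨h1, h2⟩ := hTmem F hF
      exact Finset.mem_erase.2 ⟨h2.ne, Finset.mem_erase.2 ⟨h1.ne_empty,
        Finset.mem_powerset.2 h2.1⟩⟩
    · obtain ⟨h1, h2⟩ := Finset.mem_erase.1 hF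
      obtain ⟨h3, h4⟩ := Finset.mem_erase.1 h2
      rcases hC'.density_eq_zero_or (μ := μ) hN hB ((Finset.mem_powerset.1 h4).ssubset_of_ne h1)
        (Finset.nonempty_iff_ne_empty.2 h3) with h5 | h5
      · exact h5
      · exact absurd (Finset.mem_filter.2 ⟨h4, h5⟩) hFT
  have hsum := sum_density_pathUnions_nonneg (μ := μ) C hB hs
  have hg : (C.gamma k : ℝ) = 1 ∨ (C.gamma k : ℝ) = -1 := by
    rw [gamma]
    split_ifs <;> simp
  have hgg : (C.gamma k : ℝ) * C.gamma k = 1 := by rcases hg with h | h <;> rw [h] <;> norm_num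
  have habs : |(C.gamma k : ℝ)| = 1 := by rcases hg with h | h <;> rw [h] <;> norm_num
  rw [density_half_one_add C hB, h1, hC.density_eq_gamma_mul hk hB]
  have h2 : (1 / 2 : ℝ) ^ C.edges.card * (1 + (C.gamma k * (D k).density μ B +
      ∑ F ∈ T, (C.spanning F).density μ B)) - (1 / 2) ^ C.edges.card
      = (1 / 2 : ℝ) ^ C.edges.card * (C.gamma k * (D k).density μ B +
        ∑ F ∈ T, (C.spanning F).density μ B) := by ring
  have hpos : (0 : ℝ) < (1 / 2) ^ C.edges.card := by positivity
  rw [h2, abs_mul, abs_of_pos hpos]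
  refine mul_le_mul_of_nonneg_left ?_ hpos.le
  calc (D k).density μ B ≤ (D k).density μ B + C.gamma k * ∑ F ∈ T, (C.spanning F).density μ B :=
        le_add_of_nonneg_right hsum
    _ = C.gamma k * (C.gamma k * (D k).density μ B + ∑ F ∈ T, (C.spanning F).density μ B) := by
        rw [mul_add, ← mul_assoc, hgg, one_mul]
    _ ≤ |C.gamma k * (C.gamma k * (D k).density μ B + ∑ F ∈ T, (C.spanning F).density μ B)| :=
        le_abs_self _
    _ = _ := by rw [abs_mul, habs, one_mul]

end Density

end Alpha

end OrientedGraph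

namespace OrientedGraph

variable {V : Type*}

/-! ### Limits -/

section Limit

variable {Ω : Type*} [MeasurableSpace Ω] {μ : Measure Ω} [IsProbabilityMeasure μ] {B : Ω → Ω → ℝ}

/-- A skew-symmetric kernel all of whose bilinear averages vanish is zero almost everywhere. -/
theorem ae_eq_zero_of_bilinear_eq_zero (hB : IsSkewKernel B)
    (h : ∀ f g : Ω → ℝ, IsUnitBounded f → IsUnitBounded g →
      ∫ p, f p.1 * B p.1 p.2 * g p.2 ∂(μ.prod μ) = 0) :
    ∀ᵐ p ∂(μ.prod μ), B p.1 p.2 = 0 := by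
  have hind : ∀ s : Set Ω, MeasurableSet s → IsUnitBounded (s.indicator fun _ => (1 : ℝ)) :=
    fun s hs => ⟨measurable_const.indicator hs, fun x => by
      by_cases hx : x ∈ s <;> simp [hx]⟩
  have hBi : Integrable (fun p : Ω × Ω => B p.1 p.2) (μ.prod μ) :=
    hB.isUnitBounded.integrable
  have hBi1 : Integrable (fun p : Ω × Ω => 1 + B p.1 p.2) (μ.prod μ) :=
    (integrable_const _).add hBi
  have hpos : ∀ p : Ω × Ω, 0 ≤ 1 + B p.1 p.2 := fun p => by
    have := (abs_le.1 (hB.abs_le p.1 p.2)).1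
    linarith
  have hm : Measurable fun p : Ω × Ω => ENNReal.ofReal (1 + B p.1 p.2) :=
    (measurable_const.add hB.measurable).ennreal_ofReal
  -- The measure with density $1+B\ge 0$ agrees with the product measure on rectangles, since the
  -- integrals of `B` over them vanish. Uniqueness of the product measure then yields $1+B=1$ almost
  -- everywhere.
  have key : μ.prod μ = (μ.prod μ).withDensity fun p => ENNReal.ofReal (1 + B p.1 p.2) := by
    refine Measure.prod_eq fun s t hs ht => ?_
    rw [withDensity_apply _ (hs.prod ht), ← ofReal_integral_eq_lintegral_ofReal
      hBi1.integrableOn (.of_forall hpos)]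
    have h0 : ∫ p in s ×ˢ t, B p.1 p.2 ∂(μ.prod μ) = 0 := by
      rw [← integral_indicator (hs.prod ht), ← h _ _ (hind s hs) (hind t ht)]
      refine integral_congr_ae (.of_forall fun p => ?_)
      by_cases h1 : p.1 ∈ s <;> by_cases h2 : p.2 ∈ t <;> simp [Set.indicator, h1, h2]
    rw [integral_add (integrable_const _).integrableOn hBi.integrableOn, h0, add_zero]
    simp [Measure.real, Measure.prod_prod]
  have h1 : (μ.prod μ).withDensity (fun p => ENNReal.ofReal (1 + B p.1 p.2))
      = (μ.prod μ).withDensity 1 := by rw [← key, withDensity_one]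
  rw [withDensity_eq_iff_of_sigmaFinite hm.aemeasurable measurable_one.aemeasurable] at h1
  filter_upwards [h1] with p hp
  have : 1 + B p.1 p.2 = 1 := by
    rwa [Pi.one_apply, ENNReal.ofReal_eq_one] at hp
  linarith

theorem isSkewKernel_of_tournamenton {W : I → I → ℝ} (hW : IsTournamenton W) :
    IsSkewKernel fun x y => 2 * W x y - 1 where
  measurable := (hW.measurable.const_mul 2).sub_const 1
  abs_le x y := by
    have h1 := hW.nonneg x y
    have h2 := hW.nonneg y x
    have h3 := hW.add_swap x y
    rw [abs_le]
    constructor <;> linarith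
  swap x y := by
    have h3 := hW.add_swap x y
    linarith

theorem IsCycleOrientation.isLimitQuasirandomForcing [Fintype V] {C : OrientedGraph V} {k : ℕ}
    (hk : 2 ≤ k) (hC : C.IsCycleOrientation (2 * k))
    (hs : ∀ (m : ℕ) (n : Fin m → ℕ), 0 < m → (∀ i, 0 < n i) → 0 ≤ C.gamma k * C.alpha n) :
    C.IsLimitQuasirandomForcing := by
  intro W hW hdens
  have hB := isSkewKernel_of_tournamenton hW
  have h1 := hC.density_D_le (μ := (volume : Measure I)) hk hB hs
  have h2 : C.density volume (fun x y => (1 + (2 * W x y - 1)) / 2) = (1 / 2) ^ C.edges.card := by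
    rw [← hdens]
    have : ∀ x y, (1 + (2 * W x y - 1)) / 2 = W x y := fun x y => by ring
    simp only [this]
    rfl
  rw [h2, sub_self, abs_zero] at h1
  have h3 : (D k).density volume (fun x y => 2 * W x y - 1) ≤ 0 := by
    have hpos : (0 : ℝ) < (1 / 2) ^ C.edges.card := by positivity
    by_contra! h
    exact absurd h1 (not_le.2 (mul_pos hpos h))
  have h4 := ae_eq_zero_of_bilinear_eq_zero (μ := (volume : Measure I)) hB fun f g hf hg => by
    have h5 := (abs_bilinear_pow_le (μ := (volume : Measure I)) hk hB hf hg).trans h3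
    exact abs_eq_zero.1 (pow_eq_zero_iff (by positivity) |>.1
      (le_antisymm h5 (pow_nonneg (abs_nonneg _) _)))
  filter_upwards [h4] with p hp
  linarith

end Limit

/-! ### Finite tournaments -/

section Finite

/-- Each of the fewer than $2^{\|H\|}$ nonempty edge sets contributes at most `ε`, and the prefactor
$2^{-\|H\|}$ compensates for their number. -/
theorem abs_density_half_one_add_sub_le {Ω : Type*} [MeasurableSpace Ω] {μ : Measure Ω}
    [IsProbabilityMeasure μ] {B : Ω → Ω → ℝ} [Fintype V] (H : OrientedGraph V)
    (hB : IsSkewKernel B) {ε : ℝ} (hε0 : 0 ≤ ε)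
    (hε : ∀ f g : Ω → ℝ, IsUnitBounded f → IsUnitBounded g →
      |∫ p, f p.1 * B p.1 p.2 * g p.2 ∂(μ.prod μ)| ≤ ε) :
    |H.density μ (fun x y => (1 + B x y) / 2) - (1 / 2) ^ H.edges.card| ≤ ε := by
  classical
  rw [density_half_one_add H hB, ← Finset.add_sum_erase _ _ (Finset.empty_mem_powerset _),
    density_spanning_empty, mul_add, mul_one, add_sub_cancel_left, abs_mul,
    abs_of_nonneg (by positivity)]
  have h1 : |∑ F ∈ H.edges.powerset.erase ∅, (H.spanning F).density μ B|
      ≤ 2 ^ H.edges.card * ε := by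
    refine (Finset.abs_sum_le_sum_abs _ _).trans ((Finset.sum_le_card_nsmul _ _ ε ?_).trans ?_)
    · intro F hF
      obtain ⟨h1, h2⟩ := Finset.mem_erase.1 hF
      refine abs_density_le _ hB (fun f g hf hg hf' hg' => hε f g ⟨hf, hf'⟩ ⟨hg, hg'⟩) ?_
      rw [edges_spanning (Finset.mem_powerset.1 h2)]
      exact Finset.nonempty_iff_ne_empty.2 h1
    · rw [nsmul_eq_mul]
      refine mul_le_mul_of_nonneg_right ?_ hε0
      have := Finset.card_erase_le (s := H.edges.powerset) (a := ∅)
      rw [Finset.card_powerset] at this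
      exact_mod_cast this
  calc (1 / 2) ^ H.edges.card * |∑ F ∈ H.edges.powerset.erase ∅, (H.spanning F).density μ B|
      ≤ (1 / 2) ^ H.edges.card * (2 ^ H.edges.card * ε) :=
        mul_le_mul_of_nonneg_left h1 (by positivity)
    _ = ε := by rw [← mul_assoc, ← mul_pow]; norm_num

open Classical in
/-- The skew-symmetric kernel of a finite oriented graph. -/
noncomputable def skewKernel {W : Type*} (T : OrientedGraph W) (x y : W) : ℝ :=
  if T.Adj x y then 1 else if T.Adj y x then -1 else 0

variable {N : ℕ}

theorem isSkewKernel_skewKernel (T : OrientedGraph (Fin N)) : IsSkewKernel T.skewKernel where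
  measurable := .of_discrete
  abs_le x y := by
    unfold skewKernel
    split_ifs <;> simp
  swap x y := by
    have := T.asymm x y
    unfold skewKernel
    split_ifs <;> simp_all

/-- On the diagonal the left side is $1/2$ but the indicator is 0; this is the only source of the
error between `homDensity` and `density`. -/
theorem one_add_skewKernel_div_two {T : OrientedGraph (Fin N)} (hT : T.IsTournament)
    {x y : Fin N} (hxy : x ≠ y) [Decidable (T.Adj x y)] :
    (1 + T.skewKernel x y) / 2 = if T.Adj x y then 1 else 0 := by
  have := hT x y hxy
  have := T.asymm x y
  unfold skewKernel
  split_ifs <;> simp_all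

variable [NeZero N]

/-- The uniform probability measure on `Fin N`. -/
noncomputable def uniformMeasure (N : ℕ) [NeZero N] : Measure (Fin N) :=
  (PMF.uniformOfFintype (Fin N)).toMeasure

instance : IsProbabilityMeasure (uniformMeasure N) := by
  unfold uniformMeasure
  infer_instance

theorem uniformMeasure_real_singleton (x : Fin N) : (uniformMeasure N).real {x} = (N : ℝ)⁻¹ := by
  rw [Measure.real, uniformMeasure, PMF.toMeasure_apply_singleton _ _ (measurableSet_singleton _),
    PMF.uniformOfFintype_apply]
  simp

open Classical in
theorem homDensity_eq_integral [Fintype V] (H : OrientedGraph V) (T : OrientedGraph (Fin N)) :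
    H.homDensity T = ∫ x : V → Fin N, ∏ e ∈ H.edges, (if T.Adj (x e.1) (x e.2) then (1 : ℝ) else 0)
      ∂(Measure.pi fun _ => uniformMeasure N) := by
  have hreal : ∀ x : V → Fin N, (Measure.pi fun _ : V => uniformMeasure N).real {x}
      = (Fintype.card (V → Fin N) : ℝ)⁻¹ := fun x => by
    rw [Measure.real, Measure.pi_singleton, ENNReal.toReal_prod]
    have : ∀ v, ((uniformMeasure N) {x v}).toReal = (N : ℝ)⁻¹ := fun v =>
      uniformMeasure_real_singleton _
    simp [this]
  rw [integral_fintype .of_finite]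
  simp only [hreal, smul_eq_mul, Finset.prod_ite_zero, Finset.prod_const_one, mem_edges, Prod.forall]
  rw [← Finset.mul_sum, Finset.sum_boole, homDensity, Nat.card_eq_fintype_card,
    Nat.card_eq_fintype_card, Fintype.card_subtype, div_eq_inv_mul]

theorem integral_eq_coordinates [Fintype V] {u v : V} (huv : u ≠ v) :
    ∫ x : V → Fin N, (if x u = x v then (1 : ℝ) else 0) ∂(Measure.pi fun _ => uniformMeasure N)
      = (N : ℝ)⁻¹ := by
  have hinj : Function.Injective ![u, v] := by
    intro i j h
    fin_cases i <;> fin_cases j <;> simp_all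
  have h1 := integral_comp_injective (μ := uniformMeasure N) hinj
    (G := fun y => if y 0 = y 1 then (1 : ℝ) else 0) .of_discrete
  have h2 := (measurePreserving_finTwoArrow (uniformMeasure N)).integral_comp'
    (g := fun p : Fin N × Fin N => if p.1 = p.2 then (1 : ℝ) else 0)
  refine h1.trans (h2.trans ?_)
  rw [integral_prod _ .of_finite]
  have h3 : ∀ x : Fin N, ∫ y, (if x = y then (1 : ℝ) else 0) ∂(uniformMeasure N) = (N : ℝ)⁻¹ := by
    intro x
    rw [integral_fintype .of_finite]
    simp [uniformMeasure_real_singleton]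
  simp [h3]

/-- The two integrands lie in $[0,1]$ and differ only where the ends of some edge coincide, so a
union bound over the edges suffices. -/
theorem abs_homDensity_sub_density_le [Fintype V] (H : OrientedGraph V)
    {T : OrientedGraph (Fin N)} (hT : T.IsTournament) :
    |H.homDensity T - H.density (uniformMeasure N) (fun x y => (1 + T.skewKernel x y) / 2)|
      ≤ H.edges.card * (N : ℝ)⁻¹ := by
  classical
  rw [homDensity_eq_integral, density, ← integral_sub .of_finite .of_finite]
  refine abs_integral_le_integral_abs.trans ?_
  have hpt : ∀ x : V → Fin N,
      |(∏ e ∈ H.edges, if T.Adj (x e.1) (x e.2) then (1 : ℝ) else 0) -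
        ∏ e ∈ H.edges, (1 + T.skewKernel (x e.1) (x e.2)) / 2| ≤
      ∑ e ∈ H.edges, if x e.1 = x e.2 then (1 : ℝ) else 0 := by
    intro x
    have hnn : ∀ e ∈ H.edges, (0 : ℝ) ≤ if x e.1 = x e.2 then (1 : ℝ) else 0 := fun e _ => by
      split_ifs <;> norm_num
    by_cases h : ∃ e ∈ H.edges, x e.1 = x e.2
    · obtain ⟨e, he, hxe⟩ := h
      have h1 := Finset.single_le_sum hnn he
      rw [if_pos hxe] at h1
      refine le_trans ?_ h1
      have hk : ∀ e : V × V, 0 ≤ (1 + T.skewKernel (x e.1) (x e.2)) / 2 ∧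
          (1 + T.skewKernel (x e.1) (x e.2)) / 2 ≤ 1 := fun e => by
        have := abs_le.1 ((isSkewKernel_skewKernel T).abs_le (x e.1) (x e.2))
        constructor <;> linarith
      have hi : ∀ e : V × V, (0 : ℝ) ≤ (if T.Adj (x e.1) (x e.2) then (1 : ℝ) else 0) ∧
          (if T.Adj (x e.1) (x e.2) then (1 : ℝ) else 0) ≤ (1 : ℝ) := fun e => by
        split_ifs <;> norm_num
      have a1 := Finset.prod_nonneg fun e (_ : e ∈ H.edges) => (hk e).1
      have a2 := Finset.prod_le_one (fun e (_ : e ∈ H.edges) => (hk e).1) fun e _ => (hk e).2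
      have a3 := Finset.prod_nonneg fun e (_ : e ∈ H.edges) => (hi e).1
      have a4 := Finset.prod_le_one (fun e (_ : e ∈ H.edges) => (hi e).1) fun e _ => (hi e).2
      rw [abs_le]
      constructor <;> linarith
    · push Not at h
      rw [Finset.prod_congr rfl fun e he => (one_add_skewKernel_div_two hT (h e he)).symm,
        sub_self, abs_zero]
      exact Finset.sum_nonneg hnn
  refine (integral_mono .of_finite .of_finite hpt).trans_eq ?_
  rw [integral_finsetSum _ fun _ _ => .of_finite]
  have : ∀ e ∈ H.edges, ∫ x : V → Fin N, (if x e.1 = x e.2 then (1 : ℝ) else 0)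
      ∂(Measure.pi fun _ => uniformMeasure N) = (N : ℝ)⁻¹ := fun e he =>
    integral_eq_coordinates fun h => H.not_adj_self e.2 (h ▸ mem_edges.1 he)
  rw [Finset.sum_congr rfl this, Finset.sum_const, nsmul_eq_mul]

/-- In a finite tournament, the deviation of the density of `C` from its expected value controls
the deviations of the densities of all oriented graphs. -/
theorem IsCycleOrientation.abs_homDensity_sub_le {U : Type*} [Fintype U] [Fintype V]
    {C : OrientedGraph V} {k : ℕ} (hk : 2 ≤ k) (hC : C.IsCycleOrientation (2 * k))
    (hs : ∀ (m : ℕ) (n : Fin m → ℕ), 0 < m → (∀ i, 0 < n i) → 0 ≤ C.gamma k * C.alpha n)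
    {T : OrientedGraph (Fin N)} (hT : T.IsTournament) (H : OrientedGraph U) :
    |H.homDensity T - (1 / 2) ^ H.edges.card| ≤ H.edges.card * (N : ℝ)⁻¹ +
      (2 ^ C.edges.card * (C.edges.card * (N : ℝ)⁻¹ +
        |C.homDensity T - (1 / 2) ^ C.edges.card|)) ^ (((2 ^ (k + 1) : ℕ) : ℝ)⁻¹) := by
  have hB := isSkewKernel_skewKernel T
  set μ := uniformMeasure N
  set d := (D k).density μ T.skewKernel
  set δ := 2 ^ C.edges.card * (C.edges.card * (N : ℝ)⁻¹ +
        |C.homDensity T - (1 / 2) ^ C.edges.card|)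
  have hd : d ≤ δ := by
    have h1 := hC.density_D_le (μ := μ) hk hB hs
    have h2 := abs_homDensity_sub_density_le C hT
    have h3 : (1 / 2) ^ C.edges.card * d ≤ C.edges.card * (N : ℝ)⁻¹ +
        |C.homDensity T - (1 / 2) ^ C.edges.card| := by
      refine h1.trans ((abs_sub_le _ (C.homDensity T) _).trans (add_le_add_left ?_ _))
      rwa [abs_sub_comm]
    calc d = 2 ^ C.edges.card * ((1 / 2) ^ C.edges.card * d) := by
          rw [← mul_assoc, ← mul_pow]; norm_num
      _ ≤ δ := mul_le_mul_of_nonneg_left h3 (by positivity)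
  have hδ : 0 ≤ δ := by positivity
  have h4 := abs_density_half_one_add_sub_le (μ := μ) H hB
    (ε := δ ^ (((2 ^ (k + 1) : ℕ) : ℝ)⁻¹)) (by positivity) fun f g hf hg => by
      have h5 := (abs_bilinear_pow_le (μ := μ) hk hB hf hg).trans hd
      rw [← Real.pow_rpow_inv_natCast (abs_nonneg _) (n := 2 ^ (k + 1)) (by positivity)]
      exact Real.rpow_le_rpow (by positivity) h5 (by positivity)
  exact (abs_sub_le _ _ _).trans (add_le_add (abs_homDensity_sub_density_le H hT) h4)

end Finite

/-! ### Sequences of tournaments -/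

section Sequence

variable {W X : Type*} [Fintype V] [Fintype W]

theorem card_edges_map (H : OrientedGraph V) (f : V ↪ W) :
    (H.map f).edges.card = H.edges.card := by
  rw [edges_map, Finset.card_map]

theorem homDensity_map_equiv [Fintype X] (H : OrientedGraph V) (e : V ≃ W) (T : OrientedGraph X) :
    (H.map e.toEmbedding).homDensity T = H.homDensity T := by
  rw [homDensity, homDensity, Nat.card_congr (e.arrowCongr (Equiv.refl X)),
    Nat.card_congr ((e.arrowCongr (Equiv.refl X)).subtypeEquiv fun f => ?_)]
  constructor
  · rintro h - - ⟨u, v, huv, rfl, rfl⟩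
    simpa using h u v huv
  · intro h u v huv
    simpa using h _ _ ⟨u, v, huv, rfl, rfl⟩

theorem IsQuasirandomSeq.tendsto_homDensity {N : ℕ → ℕ} {T : ∀ i, OrientedGraph (Fin (N i))}
    (hT : IsQuasirandomSeq T) (H : OrientedGraph V) :
    Tendsto (fun i => H.homDensity (T i)) atTop (𝓝 ((1 / 2 : ℝ) ^ H.edges.card)) := by
  have := hT _ (H.map (Fintype.equivFin V).toEmbedding)
  simpa only [homDensity_map_equiv, card_edges_map] using this

theorem IsCycleOrientation.isQuasirandomForcing {C : OrientedGraph V} {k : ℕ}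
    (hk : 2 ≤ k) (hC : C.IsCycleOrientation (2 * k))
    (hs : ∀ (m : ℕ) (n : Fin m → ℕ), 0 < m → (∀ i, 0 < n i) → 0 ≤ C.gamma k * C.alpha n) :
    C.IsQuasirandomForcing := by
  intro N T hN hT
  refine ⟨fun h => h.tendsto_homDensity C, fun h m H => ?_⟩
  rw [tendsto_iff_norm_sub_tendsto_zero]
  have hinv : Tendsto (fun i => ((N i : ℕ) : ℝ)⁻¹) atTop (𝓝 0) :=
    tendsto_inv_atTop_zero.comp (tendsto_natCast_atTop_atTop.comp hN)
  have hC0 : Tendsto (fun i => |C.homDensity (T i) - (1 / 2) ^ C.edges.card|) atTop (𝓝 0) :=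
    tendsto_iff_norm_sub_tendsto_zero.1 h
  have h1 : Tendsto (fun i => 2 ^ C.edges.card * (C.edges.card * ((N i : ℕ) : ℝ)⁻¹ +
      |C.homDensity (T i) - (1 / 2) ^ C.edges.card|)) atTop (𝓝 0) := by
    simpa using ((hinv.const_mul (C.edges.card : ℝ)).add hC0).const_mul (2 ^ C.edges.card)
  have hexp : (0 : ℝ) < (((2 ^ (k + 1) : ℕ) : ℝ)⁻¹) := by positivity
  have h2 := h1.rpow_const (p := (((2 ^ (k + 1) : ℕ) : ℝ)⁻¹)) (.inr hexp.le)
  rw [Real.zero_rpow hexp.ne'] at h2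
  have h3 := (hinv.const_mul (H.edges.card : ℝ)).add h2
  rw [mul_zero, add_zero] at h3
  refine squeeze_zero' (.of_forall fun _ => norm_nonneg _) ?_ h3
  -- The uniform measure requires a nonempty vertex set, which `hN` guarantees for all large `i`.
  filter_upwards [hN.eventually_ge_atTop 1] with i hi
  have : NeZero (N i) := ⟨by omega⟩
  exact hC.abs_homDensity_sub_le hk hs (hT i) H

end Sequence

end OrientedGraph

theorem mainTheorem4 {V : Type*} [Fintype V] (C : OrientedGraph V) (k : ℕ) (hk : 2 ≤ k)
    (hC : C.IsCycleOrientation (2 * k)) :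
    ((C.gamma k = 1 ∧
        ∀ (m : ℕ) (n : Fin m → ℕ), 0 < m → (∀ i, 0 < n i) → 0 ≤ C.alpha n) →
      C.IsQuasirandomForcing ∧ C.IsLimitQuasirandomForcing) ∧
    ((C.gamma k = -1 ∧
        ∀ (m : ℕ) (n : Fin m → ℕ), 0 < m → (∀ i, 0 < n i) → C.alpha n ≤ 0) →
      C.IsQuasirandomForcing ∧ C.IsLimitQuasirandomForcing) := by
  -- Both cases say that $\gamma_C$ and $\alpha_C$ never have opposite signs.
  have key : (∀ (m : ℕ) (n : Fin m → ℕ), 0 < m → (∀ i, 0 < n i) → 0 ≤ C.gamma k * C.alpha n) →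
      C.IsQuasirandomForcing ∧ C.IsLimitQuasirandomForcing := fun hs =>
    ⟨hC.isQuasirandomForcing hk hs, hC.isLimitQuasirandomForcing hk hs⟩
  refine ⟨fun h => key fun m n hm hn => ?_, fun h => key fun m n hm hn => ?_⟩
  · rw [h.1, one_mul]
    exact h.2 m n hm hn
  · rw [h.1, neg_one_mul]
    exact neg_nonneg.2 (h.2 m n hm hn)
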